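/- **Setting.** An instance consists of $n$ agents, $m$ indivisible goods, values $v_a(g)\in\mathbb{Z}_{\ge 0}$ and sizes $s_a(g)\in\mathbb{Z}_{\ge 0}$ for all agents $a\in[n]$ and goods $g\in[m]$, and budgets $B_a\in\mathbb{Q}_{\ge 0}$. Values and sizes are additive over sets of goods. A set $S\subseteq[m]$ is feasible for $a$ if $s_a(S)\le B_a$. An allocation $\mathcal A=(A_1,\dots,A_n)$ is a tuple of pairwise disjoint sets of goods with $A_a$ feasible for $a$; its charity is $C_{\mathcal A}=[m]\setminus\bigcup_a A_a$. It is $(1-\varepsilon)$-FEFx if $v_a(A_a)\ge(1-\varepsilon)v_a(S)$ for all agents $a,b$ and every set $S$ that is feasible for $a$ and satisfies $S\subsetneq A_b$ or $S\subsetneq C_{\mathcal A}$. A set $T$ is $(1-\varepsilon)$-envied by $a$ if $v_a(A_a)<(1-\varepsilon)v_a(S)$ for some $S\subseteq T$ feasible for $a$. A set $T$ is $(1-\varepsilon)$-minimal envied, with agent $k$, if it is feasible for $k$ and $(1-\varepsilon/2)$-envied by $k$, and no strict subset of $T$ is $(1-\varepsilon)$-envied by any agent. **Algorithm.** A knapsack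 routine is $(1-\delta)$-approximate (for every $\delta\in(0,1]$) if it selects a subset of the available items that fits into the knapsack and has at least $1-\delta$ times the maximum value. Let $\mathtt{ApxKns}(a,T,\delta)$ be its output on the items $T$ with values $v_a$, weights $s_a$ and capacity $B_a$. Say that $a$ *passes the test on* $T$ (under $\mathcal A$) if $v_a(A_a)<(1-\frac\varepsilon2)\,v_a(\mathtt{ApxKns}(a,T,\frac\varepsilon2))$. ComputeApproxFEFx starts with $\mathcal A=(\emptyset,\dots,\emptyset)$. While some agent passes the test on the charity $C=C_{\mathcal A}$, it sets $A_k\leftarrow T$ for a pair $(T,k)$ returned by $\mathtt{ApxMinEnvied}$; then it returns $\mathcal A$. The subroutine $\mathtt{ApxMinEnvied}$ starts with $T=C$ and some agent $k$ that passes the test on $C$; while some agent $a'$ passes the test on $T\setminus\{g'\}$ for some $g'\in T$, it sets $T\leftarrow T\setminus\{g'\}$, $k\leftarrow a'$; finally it sets $T\leftarrow\mathtt{ApxKns}(k,T,\frac\varepsilon2)$ and returns $(T,k)$. All choices of agents and goods are arbitrary. The input size is $n+m$ plus the number of bits of all the values, sizes, and numerators and denominators of the budgets and of $\varepsilon$.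 Running time is measured on a random access machine with logarithmic (bit) cost. **Theorem.** 1. There are constants $c,d$ such that for every $(1-\delta)$-approximate knapsack routine, every instance and every rational $\varepsilon\in(0,1)$, the following holds for every run of ComputeApproxFEFx. It performs at most $c\,(1/\varepsilon+\text{input size})^d$ iterations of its while-loop. The maintained tuple is always an allocation. Whenever the loop condition holds, $\mathtt{ApxMinEnvied}$ can return some pair, and each pair $(T,k)$ that it can return consists of a $(1-\varepsilon)$-minimal envied set $T\subseteq C$ and a corresponding agent $k$, with $v_k(T)>\frac{1}{1-\varepsilon/2}\,v_k(A_k)$, so that the value of the updated agent increases by a factor larger than $\frac1{1-\varepsilon/2}$. The returned $\mathcal A$ is a $(1-\varepsilon)$-FEFx allocation. 2. There is an FPTAS for the knapsack problem (a $(1-\delta)$-approximate routine computed by a program in time polynomial in $1/\delta$ and the size of its input) with which ComputeApproxFEFx is an FPTAS for FEFx: a single program, given any instance and any rational $\varepsilon\in(0,1)$, halts within time polynomial in $1/\varepsilon$ and the input size, and outputs an allocation that is returned by ComputeApproxFEFx with this knapsack routine and that is $(1-\varepsilon)$-FEFx. -/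

import Mathlib

open scoped NNRat

namespace FairDivision

/-! ### Fair division instances with generalized assignment constraints -/

/-- `n` agents, `m` indivisible goods, integral values and sizes, rational budgets. -/
structure FairInstance where
  n : ℕ
  m : ℕ
  val : Fin n → Fin m → ℕ
  size : Fin n → Fin m → ℕ
  budget : Fin n → ℚ≥0

namespace FairInstance

variable (I : FairInstance)

/-- A tuple of bundles, one for each agent. -/
abbrev Bundles : Type := Fin I.n → Finset (Fin I.m)

/-- The additive valuation of agent `a`. -/
def value (a : Fin I.n) (S : Finset (Fin I.m)) : ℚ := ∑ g ∈ S, (I.val a g : ℚ)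

/-- `S` is feasible for agent `a`: its total size for `a` is within the budget of `a`. -/
def Feasible (a : Fin I.n) (S : Finset (Fin I.m)) : Prop :=
  ∑ g ∈ S, (I.size a g : ℚ) ≤ (I.budget a : ℚ)

/-- The goods that are not assigned to any agent. -/
def charity (A : I.Bundles) : Finset (Fin I.m) := Finset.univ \ Finset.univ.biUnion A

/-- A (feasible) allocation. -/
def IsAllocation (A : I.Bundles) : Prop :=
  (∀ a b, a ≠ b → Disjoint (A a) (A b)) ∧ ∀ a, I.Feasible a (A a)

/-- The `(1 - ε)`-FEFx property. -/
def IsApproxFEFx (ε : ℚ) (A : I.Bundles) : Prop :=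
  (∀ a b, ∀ S, S ⊂ A b → I.Feasible a S → (1 - ε) * I.value a S ≤ I.value a (A a)) ∧
  (∀ a, ∀ S, S ⊂ I.charity A → I.Feasible a S → (1 - ε) * I.value a S ≤ I.value a (A a))

/-- Under `A`, the set `T` is `(1 - ε)`-envied by agent `a`. -/
def ApproxEnvies (ε : ℚ) (A : I.Bundles) (a : Fin I.n) (T : Finset (Fin I.m)) : Prop :=
  ∃ S ⊆ T, I.Feasible a S ∧ I.value a (A a) < (1 - ε) * I.value a S

/-- Under `A`, the set `T` is a `(1 - ε)`-minimal envied set, as witnessed by agent `k`. -/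
def IsApproxMinEnvied (ε : ℚ) (A : I.Bundles) (T : Finset (Fin I.m)) (k : Fin I.n) : Prop :=
  (I.ApproxEnvies (ε / 2) A k T ∧ I.Feasible k T) ∧
  ∀ T', T' ⊂ T → ∀ k', ¬ I.ApproxEnvies ε A k' T'

/-- The size of the input `(I, ε)`: the number of agents and goods, plus the number of bits of all
the numbers in the input. -/
def inputSize (ε : ℚ) : ℕ :=
  I.n + I.m + (∑ a, ∑ g, ((I.val a g).size + (I.size a g).size))
    + (∑ a, ((I.budget a).num.size + (I.budget a).den.size))
    + ε.num.natAbs.size + ε.den.size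

end FairInstance

/-! ### Knapsack routines -/

/-- A routine that, given values `v` and weights `w` of the items `Fin m`, a set `T` of available
items, a capacity `W` and an accuracy parameter `δ`, selects a set of items. -/
abbrev KnapsackRoutine : Type :=
  (m : ℕ) → (v w : Fin m → ℕ) → (T : Finset (Fin m)) → (W : ℚ≥0) → (δ : ℚ) → Finset (Fin m)

/-- The selected items are available, fit into the knapsack, and have at least `1 - δ` times the
value of any other such selection. -/
def KnapsackRoutine.IsApproximate (K : KnapsackRoutine) : Prop :=
  ∀ (m : ℕ) (v w : Fin m → ℕ) (T : Finset (Fin m)) (W : ℚ≥0) (δ : ℚ), 0 < δ → δ ≤ 1 →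
    K m v w T W δ ⊆ T ∧
    ∑ g ∈ K m v w T W δ, (w g : ℚ) ≤ (W : ℚ) ∧
    ∀ S ⊆ T, ∑ g ∈ S, (w g : ℚ) ≤ (W : ℚ) →
      (1 - δ) * ∑ g ∈ S, (v g : ℚ) ≤ ∑ g ∈ K m v w T W δ, (v g : ℚ)

/-- The size of the input of a knapsack routine. -/
def knapsackInputSize (m : ℕ) (v w : Fin m → ℕ) (W : ℚ≥0) (δ : ℚ) : ℕ :=
  m + (∑ g, ((v g).size + (w g).size)) + W.num.size + W.den.size
    + δ.num.natAbs.size + δ.den.size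

/-! ### The algorithm `ComputeApproxFEFx`

The knapsack routine `K` is a parameter. Wherever the algorithm picks some agent or some good with
a certain property, every choice is allowed. -/

section Algorithm

variable (K : KnapsackRoutine) (I : FairInstance) (ε : ℚ)

/-- `ApxKns(a, T, δ)`: the knapsack routine for agent `a` on the set of goods `T`. -/
def apxKns (a : Fin I.n) (T : Finset (Fin I.m)) (δ : ℚ) : Finset (Fin I.m) :=
  K I.m (I.val a) (I.size a) T (I.budget a) δ

/-- The test `v_a(A_a) < (1 - ε/2) v_a(ApxKns(a, T, ε/2))` of both while-loops. -/
def Test (A : I.Bundles) (a : Fin I.n) (T : Finset (Fin I.m)) : Prop :=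
  I.value a (A a) < (1 - ε / 2) * I.value a (apxKns K I a T (ε / 2))

/-- One iteration of the while-loop of `ApxMinEnvied`: `T ← T - g'` and `k ← a'`. -/
def ShrinkStep (A : I.Bundles) (x y : Finset (Fin I.m) × Fin I.n) : Prop :=
  ∃ g' ∈ x.1, ∃ a', Test K I ε A a' (x.1.erase g') ∧ y = (x.1.erase g', a')

/-- `(T, k)` can be returned by the subroutine `ApxMinEnvied(C, A, ε)` with `C` the charity:
start with `T₀ = C` and an agent that passes the test, iterate the while-loop until its condition
fails, and finally replace `T₀` by `ApxKns(k, T₀, ε/2)`. -/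
def ApxMinEnvied (A : I.Bundles) (T : Finset (Fin I.m)) (k : Fin I.n) : Prop :=
  ∃ k₀ T₀, Test K I ε A k₀ (I.charity A) ∧
    Relation.ReflTransGen (ShrinkStep K I ε A) (I.charity A, k₀) (T₀, k) ∧
    (∀ g' ∈ T₀, ∀ a', ¬ Test K I ε A a' (T₀.erase g')) ∧
    T = apxKns K I k T₀ (ε / 2)

/-- The condition of the while-loop of `ComputeApproxFEFx`. -/
def LoopCondition (A : I.Bundles) : Prop := ∃ a, Test K I ε A a (I.charity A)

/-- `A` can be the maintained allocation after `t` iterations of the while-loop of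
`ComputeApproxFEFx`. -/
inductive AfterIterations : ℕ → I.Bundles → Prop
  | start : AfterIterations 0 (fun _ => ∅)
  | update {t : ℕ} {A : I.Bundles} {T : Finset (Fin I.m)} {k : Fin I.n} :
      AfterIterations t A → LoopCondition K I ε A → ApxMinEnvied K I ε A T k →
      AfterIterations (t + 1) (Function.update A k T)

/-- `ComputeApproxFEFx` can return the allocation `A`. -/
def Returns (A : I.Bundles) : Prop :=
  (∃ t, AfterIterations K I ε t A) ∧ ¬ LoopCondition K I ε A

end Algorithm

/-! ### The machine model: random access machines with logarithmic cost

Structured programs over natural-number registers `reg 0, reg 1, …` and arrays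
`arr 0, arr 1, …`; the number of bits of every number (also of every address) that is touched is
charged for. -/

structure Memory where
  reg : ℕ → ℕ
  arr : ℕ → ℕ → ℕ

inductive BinOp
  | add | sub | mul | div | lt

/-- Subtraction is truncated, division is floored with `x / 0 = 0`, comparison returns `0` or `1`. -/
def BinOp.eval : BinOp → ℕ → ℕ → ℕ
  | .add, x, y => x + y
  | .sub, x, y => x - y
  | .mul, x, y => x * y
  | .div, x, y => x / y
  | .lt, x, y => if x < y then 1 else 0

inductive Expr
  | const (c : ℕ)
  | reg (r : ℕ)
  | arr (α : ℕ) (i : Expr)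
  | op (o : BinOp) (e₁ e₂ : Expr)

def Expr.eval (s : Memory) : Expr → ℕ
  | .const c => c
  | .reg r => s.reg r
  | .arr α i => s.arr α (i.eval s)
  | .op o e₁ e₂ => o.eval (e₁.eval s) (e₂.eval s)

/-- The bit cost of evaluating an expression. -/
def Expr.cost (s : Memory) : Expr → ℕ
  | .const c => 1 + c.size
  | .reg r => 1 + (s.reg r).size
  | .arr α i => i.cost s + 1 + (i.eval s).size + (s.arr α (i.eval s)).size
  | .op _ e₁ e₂ => e₁.cost s + e₂.cost s + (1 + (e₁.eval s).size) * (1 + (e₂.eval s).size)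

inductive Program
  | skip
  | setReg (r : ℕ) (e : Expr)
  | setArr (α : ℕ) (i e : Expr)
  | seq (p q : Program)
  | branch (b : Expr) (p q : Program)
  | loop (b : Expr) (p : Program)

def Memory.setReg (s : Memory) (r x : ℕ) : Memory :=
  { s with reg := Function.update s.reg r x }

def Memory.setArr (s : Memory) (α i x : ℕ) : Memory :=
  { s with arr := Function.update s.arr α (Function.update (s.arr α) i x) }

/-- `Exec p s s' t`: started in memory `s`, the program `p` halts in memory `s'` after time `t`.
A condition holds if its value is nonzero; `loop b p` is the loop `while b do p`. -/
inductive Exec : Program → Memory → Memory → ℕ → Prop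
  | skip {s} : Exec .skip s s 1
  | setReg {s r e} :
      Exec (.setReg r e) s (s.setReg r (e.eval s)) (1 + e.cost s + (e.eval s).size)
  | setArr {s α i e} :
      Exec (.setArr α i e) s (s.setArr α (i.eval s) (e.eval s))
        (1 + i.cost s + e.cost s + (i.eval s).size + (e.eval s).size)
  | seq {p q s s' s'' t t'} :
      Exec p s s' t → Exec q s' s'' t' → Exec (.seq p q) s s'' (1 + t + t')
  | branchTrue {b p q s s' t} :
      b.eval s ≠ 0 → Exec p s s' t → Exec (.branch b p q) s s' (1 + b.cost s + t)
  | branchFalse {b p q s s' t} :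
      b.eval s = 0 → Exec q s s' t → Exec (.branch b p q) s s' (1 + b.cost s + t)
  | loopTrue {b p s s' s'' t t'} :
      b.eval s ≠ 0 → Exec p s s' t → Exec (.loop b p) s' s'' t' →
      Exec (.loop b p) s s'' (1 + b.cost s + t + t')
  | loopFalse {b p s} :
      b.eval s = 0 → Exec (.loop b p) s s (1 + b.cost s)

/-! ### Input and output -/

/-- A vector as the contents of an array, padded with zeros. -/
def ofVector {n : ℕ} (f : Fin n → ℕ) (i : ℕ) : ℕ :=
  if h : i < n then f ⟨i, h⟩ else 0

/-- A matrix as the contents of an array in row-major order (entry `(a, g)` is in cell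
`a * m + g`), padded with zeros. -/
def ofMatrix {n m : ℕ} (f : Fin n → Fin m → ℕ) (i : ℕ) : ℕ :=
  if h : i / m < n ∧ i % m < m then f ⟨i / m, h.1⟩ ⟨i % m, h.2⟩ else 0

/-- The initial memory on input `(I, ε)`. -/
def fairInput (I : FairInstance) (ε : ℚ) : Memory where
  reg
    | 0 => I.n
    | 1 => I.m
    | 2 => ε.num.natAbs
    | 3 => ε.den
    | _ => 0
  arr
    | 0 => ofMatrix I.val
    | 1 => ofMatrix I.size
    | 2 => ofVector fun a => (I.budget a).num
    | 3 => ofVector fun a => (I.budget a).den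
    | _ => fun _ => 0

/-- Array `4` holds the allocation `A`: its cell `g` is `a + 1` if good `g` is assigned to
agent `a`, and `0` if good `g` is in the charity. -/
def FairOutput (I : FairInstance) (A : I.Bundles) (s : Memory) : Prop :=
  ∀ g : Fin I.m, (∀ a : Fin I.n, g ∈ A a → s.arr 4 g = a + 1) ∧
    (g ∈ I.charity A → s.arr 4 g = 0)

/-- The initial memory on a knapsack input. -/
def knapsackInput (m : ℕ) (v w : Fin m → ℕ) (T : Finset (Fin m)) (W : ℚ≥0) (δ : ℚ) : Memory where
  reg
    | 0 => m
    | 1 => W.num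
    | 2 => W.den
    | 3 => δ.num.natAbs
    | 4 => δ.den
    | _ => 0
  arr
    | 0 => ofVector v
    | 1 => ofVector w
    | 2 => ofVector fun g => if g ∈ T then 1 else 0
    | _ => fun _ => 0

/-- Array `3` holds the indicator vector of `S`. -/
def KnapsackOutput {m : ℕ} (S : Finset (Fin m)) (s : Memory) : Prop :=
  ∀ g : Fin m, s.arr 3 g = if g ∈ S then 1 else 0

/-- `K` is a fully polynomial-time approximation scheme for the knapsack problem: it is
`(1 - δ)`-approximate, and computed by a program in time polynomial in `1 / δ` and the input
size. -/
def KnapsackRoutine.IsFPTAS (K : KnapsackRoutine) : Prop :=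
  K.IsApproximate ∧
  ∃ (Q : Program) (c d : ℕ),
    ∀ (m : ℕ) (v w : Fin m → ℕ) (T : Finset (Fin m)) (W : ℚ≥0) (δ : ℚ), 0 < δ → δ ≤ 1 →
      ∃ (s : Memory) (t : ℕ), Exec Q (knapsackInput m v w T W δ) s t ∧
        KnapsackOutput (K m v w T W δ) s ∧
        (t : ℚ) ≤ c * (1 / δ + knapsackInputSize m v w W δ) ^ d

end FairDivision

open FairDivision

/-! Correctness for an arbitrary routine. A set that fails the test for an agent has no subset that
this agent `(1 - ε)`-envies: two factors `1 - ε/2` are lost, one in the knapsack routine and one in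
the test, and `(1 - ε/2)² ≥ 1 - ε` (`not_approxEnvies_of_not_test`). When `ApxMinEnvied` stops at
`T₀`, every `T₀.erase g` fails the test for every agent, and each strict subset of the selection `T
⊆ T₀` lies in such a set; hence `T` is minimal envied (`ApxMinEnvied.spec`). The agent `k` passed
the test on `T₀`, which says exactly that `T` is worth more than `1 / (1 - ε/2)` times the old
bundle of `k`. Values of the agents never decrease, so what holds for a bundle when it is assigned
persists (`AfterIterations.approxFEFx_bundles`); the charity is covered by the failing loop
condition.

Number of iterations. The first update of an agent gives it a positive integral value, and each
later one multiplies the value by more than `1 + ε/2`. All values are at most `2 ^ I.inputSize ε`,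
so each agent is updated at most `⌈2/ε⌉ * I.inputSize ε + 1` times (`AfterIterations.le`).

Knapsack FPTAS. Values are rounded down to multiples of `δ/m` times the largest value `top` of a
single usable item. A table indexed by the rounded value stores the least weight together with a
selection, encoded as a bit mask. Rounding costs at most `δ * top`, which is at most a `δ` fraction
of the optimum (`mask_approx`). The table has about `m²/δ` columns (`scaledBound_le`).

Machine time. Programs are analysed with unit cost (`Run`, `Halts`). If no stored value is built by
multiplication, one step adds only constantly many bits to the stored numbers, so `k` steps from
`M`-bit memory keep `M + O(k)` bits and have bit cost polynomial in `k` and `M` (`Run.exec`). It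
then suffices to bound steps: the dynamic program is run for each agent in `searchProgram`, the
search at most `O(m²)` times in each `ApxMinEnvied`, and that within each of the polynomially many
iterations. -/

namespace FairDivision

/-! ### Expressions -/

instance : Add Expr := ⟨.op .add⟩
instance : Sub Expr := ⟨.op .sub⟩
instance : Mul Expr := ⟨.op .mul⟩
instance : Div Expr := ⟨.op .div⟩
instance (n : ℕ) : OfNat Expr n := ⟨.const n⟩

/-- The comparison `e₁ < e₂`. -/
abbrev Expr.less (e₁ e₂ : Expr) : Expr := .op .lt e₁ e₂

@[simp] theorem Expr.eval_add (s : Memory) (a b : Expr) :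
    (a + b).eval s = a.eval s + b.eval s := rfl
@[simp] theorem Expr.eval_sub (s : Memory) (a b : Expr) :
    (a - b).eval s = a.eval s - b.eval s := rfl
@[simp] theorem Expr.eval_mul (s : Memory) (a b : Expr) :
    (a * b).eval s = a.eval s * b.eval s := rfl
@[simp] theorem Expr.eval_div (s : Memory) (a b : Expr) :
    (a / b).eval s = a.eval s / b.eval s := rfl
@[simp] theorem Expr.eval_less (s : Memory) (a b : Expr) :
    (Expr.less a b).eval s = if a.eval s < b.eval s then 1 else 0 := rfl
@[simp] theorem Expr.eval_reg (s : Memory) (r : ℕ) : (Expr.reg r).eval s = s.reg r := rfl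
@[simp] theorem Expr.eval_arr (s : Memory) (α : ℕ) (i : Expr) :
    (Expr.arr α i).eval s = s.arr α (i.eval s) := rfl
@[simp] theorem Expr.eval_two (s : Memory) : (2 : Expr).eval s = 2 := rfl
@[simp] theorem Expr.eval_zero (s : Memory) : (0 : Expr).eval s = 0 := rfl
@[simp] theorem Expr.eval_one (s : Memory) : (1 : Expr).eval s = 1 := rfl

@[simp] theorem Memory.setReg_reg (s : Memory) (r x r' : ℕ) :
    (s.setReg r x).reg r' = if r' = r then x else s.reg r' := by
  simp [Memory.setReg, Function.update_apply]
@[simp] theorem Memory.setReg_arr (s : Memory) (r x : ℕ) : (s.setReg r x).arr = s.arr := rfl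
@[simp] theorem Memory.setArr_reg (s : Memory) (α i x : ℕ) : (s.setArr α i x).reg = s.reg := rfl
@[simp] theorem Memory.setArr_arr (s : Memory) (α i x β j : ℕ) :
    (s.setArr α i x).arr β j = if β = α ∧ j = i then x else s.arr β j := by
  by_cases h : β = α
  · subst h; simp [Memory.setArr, Function.update_apply]
  · simp [Memory.setArr, h]

theorem Memory.setArr_arr_of_ne (s : Memory) (α i x β : ℕ) (h : β ≠ α) :
    (s.setArr α i x).arr β = s.arr β := by
  funext j; simp [h]

/-! ### From unit cost to logarithmic cost -/

/-- `Run p s s' k`: started in memory `s`, the program `p` halts in memory `s'` after `k` steps,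
where each command counts as one step. -/
inductive Run : Program → Memory → Memory → ℕ → Prop
  | skip {s} : Run .skip s s 1
  | setReg {s r e} : Run (.setReg r e) s (s.setReg r (e.eval s)) 1
  | setArr {s α i e} : Run (.setArr α i e) s (s.setArr α (i.eval s) (e.eval s)) 1
  | seq {p q s s' s'' k k'} : Run p s s' k → Run q s' s'' k' → Run (.seq p q) s s'' (1 + k + k')
  | branchTrue {b p q s s' k} : b.eval s ≠ 0 → Run p s s' k → Run (.branch b p q) s s' (1 + k)
  | branchFalse {b p q s s' k} : b.eval s = 0 → Run q s s' k → Run (.branch b p q) s s' (1 + k)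
  | loopTrue {b p s s' s'' k k'} : b.eval s ≠ 0 → Run p s s' k → Run (.loop b p) s' s'' k' →
      Run (.loop b p) s s'' (1 + k + k')
  | loopFalse {b p s} : b.eval s = 0 → Run (.loop b p) s s 1

/-- All numbers in the memory have at most `M` bits. -/
def Memory.SizeLE (s : Memory) (M : ℕ) : Prop :=
  (∀ r, (s.reg r).size ≤ M) ∧ ∀ α i, (s.arr α i).size ≤ M

theorem Memory.SizeLE.mono {s : Memory} {M M' : ℕ} (h : s.SizeLE M) (hM : M ≤ M') :
    s.SizeLE M' :=
  ⟨fun r => (h.1 r).trans hM, fun α i => (h.2 α i).trans hM⟩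

theorem size_add_le_succ {x y k : ℕ} (hx : x.size ≤ k) (hy : y.size ≤ k) :
    (x + y).size ≤ k + 1 := by
  rw [Nat.size_le] at *
  rw [pow_succ]; omega

theorem size_mul_le_add {x y a b : ℕ} (hx : x.size ≤ a) (hy : y.size ≤ b) :
    (x * y).size ≤ a + b := by
  rw [Nat.size_le] at *
  rw [pow_add]
  exact Nat.mul_lt_mul'' hx hy

/-- A coefficient for the size of the value of an expression. -/
def Expr.width : Expr → ℕ
  | .const c => c.size
  | .reg _ => 1
  | .arr _ _ => 1
  | .op _ e₁ e₂ => e₁.width + e₂.width + 1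

theorem Expr.size_eval_le {s : Memory} {M : ℕ} (h : s.SizeLE M) (e : Expr) :
    (e.eval s).size ≤ e.width * (M + 1) := by
  induction e with
  | const c => simp only [Expr.eval, Expr.width]; nlinarith
  | reg r => have := h.1 r; simp only [Expr.eval, Expr.width]; omega
  | arr α i _ => have := h.2 α (i.eval s); simp only [Expr.eval, Expr.width]; omega
  | op o e₁ e₂ h₁ h₂ =>
    have e : (e₁.width + e₂.width + 1) * (M + 1)
        = e₁.width * (M + 1) + e₂.width * (M + 1) + (M + 1) := by ring
    simp only [Expr.eval, Expr.width, e]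
    cases o <;> simp only [BinOp.eval]
    · have := size_add_le_succ (h₁.trans (Nat.le_add_right _ (e₂.width * (M + 1))))
        (h₂.trans (Nat.le_add_left _ (e₁.width * (M + 1))))
      omega
    · have := Nat.size_le_size (Nat.sub_le (e₁.eval s) (e₂.eval s))
      omega
    · have := size_mul_le_add h₁ h₂
      omega
    · have := Nat.size_le_size (Nat.div_le_self (e₁.eval s) (e₂.eval s))
      omega
    · split_ifs <;> simp; omega

/-- A coefficient for the cost of an expression. -/
def Expr.costCoeff : Expr → ℕ
  | .const c => 1 + c.size
  | .reg _ => 1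
  | .arr _ i => i.costCoeff + i.width + 1
  | .op _ e₁ e₂ => e₁.costCoeff + e₂.costCoeff + (1 + e₁.width) * (1 + e₂.width)

/-- The square comes from operations, which are charged the product of two operand sizes, each
linear in `M + 1` by `Expr.size_eval_le`. -/
theorem Expr.cost_le {s : Memory} {M : ℕ} (h : s.SizeLE M) (e : Expr) :
    e.cost s ≤ e.costCoeff * (M + 1) ^ 2 := by
  induction e with
  | const c => simp only [Expr.cost, Expr.costCoeff]; nlinarith [Nat.zero_le (M * (1 + c.size))]
  | reg r => have := h.1 r; simp only [Expr.cost, Expr.costCoeff]; nlinarith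
  | arr α i hi =>
    have h₁ := h.2 α (i.eval s)
    have h₂ := i.size_eval_le h
    have h₃ : i.width * (M + 1) ≤ i.width * (M + 1) ^ 2 :=
      Nat.mul_le_mul_left _ (Nat.le_self_pow two_ne_zero _)
    have h₄ : M + 1 ≤ (M + 1) ^ 2 := Nat.le_self_pow two_ne_zero _
    simp only [Expr.cost, Expr.costCoeff, add_mul]
    omega
  | op o e₁ e₂ h₁ h₂ =>
    have h₃ : 1 + (e₁.eval s).size ≤ (1 + e₁.width) * (M + 1) := by
      have := e₁.size_eval_le h
      rw [add_mul]; omega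
    have h₄ : 1 + (e₂.eval s).size ≤ (1 + e₂.width) * (M + 1) := by
      have := e₂.size_eval_le h
      rw [add_mul]; omega
    have h₅ := Nat.mul_le_mul h₃ h₄
    have h₆ : (1 + e₁.width) * (M + 1) * ((1 + e₂.width) * (M + 1))
        = (1 + e₁.width) * (1 + e₂.width) * (M + 1) ^ 2 := by ring
    simp only [Expr.cost, Expr.costCoeff, add_mul _ _ ((M + 1) ^ 2)] at *
    omega

/-- The value of the expression has at most a constant number of bits more than the numbers in the
memory. -/
def Expr.tame : Expr → Bool
  | .const _ => true
  | .reg _ => true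
  | .arr _ _ => true
  | .op .add e₁ e₂ => e₁.tame && e₂.tame
  | .op .sub e₁ _ => e₁.tame
  | .op .mul _ _ => false
  | .op .div e₁ _ => e₁.tame
  | .op .lt _ _ => true

/-- Without products the growth is additive, in contrast to the factor in `Expr.size_eval_le`; this
is what keeps the numbers small when stored values are fed back many times. Products may still occur
inside comparisons and array indices. -/
theorem Expr.size_eval_le_of_tame {s : Memory} {M : ℕ} (h : s.SizeLE M) (e : Expr)
    (he : e.tame = true) : (e.eval s).size ≤ M + e.width := by
  induction e with
  | const c => simp only [Expr.eval, Expr.width]; omega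
  | reg r => have := h.1 r; simp only [Expr.eval, Expr.width]; omega
  | arr α i _ => have := h.2 α (i.eval s); simp only [Expr.eval, Expr.width]; omega
  | op o e₁ e₂ h₁ h₂ =>
    simp only [Expr.eval, Expr.width]
    cases o <;> simp only [BinOp.eval, Expr.tame, Bool.and_eq_true, Bool.false_eq_true] at he ⊢
    · have := size_add_le_succ ((h₁ he.1).trans (Nat.le_add_right _ e₂.width))
        ((h₂ he.2).trans (by omega : _ ≤ M + e₁.width + e₂.width))
      omega
    · have := Nat.size_le_size (Nat.sub_le (e₁.eval s) (e₂.eval s))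
      have := h₁ he
      omega
    · have := Nat.size_le_size (Nat.div_le_self (e₁.eval s) (e₂.eval s))
      have := h₁ he
      omega
    · split_ifs <;> simp; omega

/-- All expressions whose values are stored are tame. -/
def Program.tame : Program → Bool
  | .skip => true
  | .setReg _ e => e.tame
  | .setArr _ _ e => e.tame
  | .seq p q => p.tame && q.tame
  | .branch _ p q => p.tame && q.tame
  | .loop _ p => p.tame

/-- A bound on the number of bits by which the numbers can grow in one step. -/
def Program.growth : Program → ℕ
  | .skip => 0
  | .setReg _ e => e.width
  | .setArr _ _ e => e.width
  | .seq p q => p.growth + q.growth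
  | .branch _ p q => p.growth + q.growth
  | .loop _ p => p.growth

/-- A coefficient for the cost of one step. -/
def Program.costCoeff : Program → ℕ
  | .skip => 1
  | .setReg _ e => 1 + e.costCoeff + e.width
  | .setArr _ i e => 1 + i.costCoeff + e.costCoeff + i.width + e.width
  | .seq p q => p.costCoeff + q.costCoeff + 1
  | .branch b p q => p.costCoeff + q.costCoeff + 1 + b.costCoeff
  | .loop b p => p.costCoeff + 1 + b.costCoeff

theorem le_mul_succ_sq (x M : ℕ) : x ≤ x * (M + 1) ^ 2 :=
  Nat.le_mul_of_pos_right _ (by positivity)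

theorem mul_succ_le_mul_succ_sq (x M : ℕ) : x * (M + 1) ≤ x * (M + 1) ^ 2 :=
  Nat.mul_le_mul_left _ (Nat.le_self_pow two_ne_zero _)

theorem Memory.SizeLE.setReg {s : Memory} {M x : ℕ} (h : s.SizeLE M) (r : ℕ) (hx : x.size ≤ M) :
    (s.setReg r x).SizeLE M :=
  ⟨fun r' => by rw [Memory.setReg_reg]; split_ifs <;> [exact hx; exact h.1 r'], h.2⟩

theorem Memory.SizeLE.setArr {s : Memory} {M x : ℕ} (h : s.SizeLE M) (α i : ℕ)
    (hx : x.size ≤ M) : (s.setArr α i x).SizeLE M :=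
  ⟨h.1, fun β j => by rw [Memory.setArr_arr]; split_ifs <;> [exact hx; exact h.2 β j]⟩

/-- The constants `G` and `C` dominate those of all subprograms, so they stay fixed during the
induction, while `M` varies because the second half of a run starts from larger numbers. The cost is
measured against a common `M'` that bounds the sizes during the entire run, so that the costs of the
halves simply add. -/
theorem Run.exec_aux {p : Program} {s s' : Memory} {k : ℕ} (hr : Run p s s' k) :
    p.tame = true → ∀ (G C : ℕ), p.growth ≤ G → p.costCoeff ≤ C → ∀ M, s.SizeLE M →
      s'.SizeLE (M + G * k) ∧ ∀ M', M + G * k ≤ M' →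
        ∃ t, Exec p s s' t ∧ t ≤ k * (C * (M' + 1) ^ 2) := by
  induction hr with
  | skip =>
    intro _ G C _ hC M hM
    refine ⟨hM.mono (by simp), fun M' hM' => ⟨1, .skip, ?_⟩⟩
    have := le_mul_succ_sq C M'
    simp only [Program.costCoeff] at hC
    omega
  | @setReg s r e =>
    intro ht G C hG hC M hM
    simp only [Program.growth, Program.costCoeff, Program.tame] at hG hC ht
    refine ⟨(hM.mono (by simp)).setReg _
      ((e.size_eval_le_of_tame hM ht).trans (by omega)), fun M' hM' => ⟨_, .setReg, ?_⟩⟩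
    have hM₁ := hM.mono (by omega : M ≤ M')
    have h₁ := e.cost_le hM₁
    have h₂ := (e.size_eval_le hM₁).trans (mul_succ_le_mul_succ_sq _ _)
    have h₃ := le_mul_succ_sq 1 M'
    calc _ ≤ (1 + e.costCoeff + e.width) * (M' + 1) ^ 2 := by rw [add_mul, add_mul]; omega
      _ ≤ 1 * (C * (M' + 1) ^ 2) := by rw [one_mul]; gcongr
  | @setArr s α i e =>
    intro ht G C hG hC M hM
    simp only [Program.growth, Program.costCoeff, Program.tame] at hG hC ht
    refine ⟨(hM.mono (by simp)).setArr _ _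
      ((e.size_eval_le_of_tame hM ht).trans (by omega)), fun M' hM' => ⟨_, .setArr, ?_⟩⟩
    have hM₁ := hM.mono (by omega : M ≤ M')
    have h₁ := e.cost_le hM₁
    have h₂ := (e.size_eval_le hM₁).trans (mul_succ_le_mul_succ_sq _ _)
    have h₃ := le_mul_succ_sq 1 M'
    have h₄ := i.cost_le hM₁
    have h₅ := (i.size_eval_le hM₁).trans (mul_succ_le_mul_succ_sq _ _)
    calc _ ≤ (1 + i.costCoeff + e.costCoeff + i.width + e.width) * (M' + 1) ^ 2 := by
          rw [add_mul, add_mul, add_mul, add_mul]; omega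
      _ ≤ 1 * (C * (M' + 1) ^ 2) := by rw [one_mul]; gcongr
  | @seq p q s s' s'' k k' _ _ ih₁ ih₂ =>
    intro ht G C hG hC M hM
    simp only [Program.growth, Program.costCoeff, Program.tame, Bool.and_eq_true] at hG hC ht
    obtain ⟨a₁, a₂⟩ := ih₁ ht.1 G C (by omega) (by omega) M hM
    obtain ⟨b₁, b₂⟩ := ih₂ ht.2 G C (by omega) (by omega) _ a₁
    have e₀ : G * (1 + k + k') = G + G * k + G * k' := by ring
    refine ⟨b₁.mono (by omega), fun M' hM' => ?_⟩
    obtain ⟨t₁, c₁, d₁⟩ := a₂ M' (by omega)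
    obtain ⟨t₂, c₂, d₂⟩ := b₂ M' (by omega)
    refine ⟨_, .seq c₁ c₂, ?_⟩
    have h₃ := le_mul_succ_sq C M'
    rw [add_mul, add_mul]
    omega
  | @branchTrue b p q s s' k hb _ ih =>
    intro ht G C hG hC M hM
    simp only [Program.growth, Program.costCoeff, Program.tame, Bool.and_eq_true] at hG hC ht
    obtain ⟨a₁, a₂⟩ := ih ht.1 G C (by omega) (by omega) M hM
    have e₀ : G * (1 + k) = G + G * k := by ring
    refine ⟨a₁.mono (by omega), fun M' hM' => ?_⟩
    obtain ⟨t₁, c₁, d₁⟩ := a₂ M' (by omega)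
    refine ⟨_, .branchTrue hb c₁, ?_⟩
    have h₁ := b.cost_le (hM.mono (by omega : M ≤ M'))
    have h₃ := le_mul_succ_sq 1 M'
    have : (1 + b.costCoeff) * (M' + 1) ^ 2 ≤ C * (M' + 1) ^ 2 := by gcongr; omega
    rw [add_mul] at this ⊢
    omega
  | @branchFalse b p q s s' k hb _ ih =>
    intro ht G C hG hC M hM
    simp only [Program.growth, Program.costCoeff, Program.tame, Bool.and_eq_true] at hG hC ht
    obtain ⟨a₁, a₂⟩ := ih ht.2 G C (by omega) (by omega) M hM
    have e₀ : G * (1 + k) = G + G * k := by ring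
    refine ⟨a₁.mono (by omega), fun M' hM' => ?_⟩
    obtain ⟨t₁, c₁, d₁⟩ := a₂ M' (by omega)
    refine ⟨_, .branchFalse hb c₁, ?_⟩
    have h₁ := b.cost_le (hM.mono (by omega : M ≤ M'))
    have h₃ := le_mul_succ_sq 1 M'
    have : (1 + b.costCoeff) * (M' + 1) ^ 2 ≤ C * (M' + 1) ^ 2 := by gcongr; omega
    rw [add_mul] at this ⊢
    omega
  | @loopTrue b p s s' s'' k k' hb _ _ ih₁ ih₂ =>
    intro ht G C hG hC M hM
    have ht' := ht
    have hG' := hG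
    have hC' := hC
    simp only [Program.growth, Program.costCoeff, Program.tame] at hG' hC' ht'
    obtain ⟨a₁, a₂⟩ := ih₁ ht' G C (by omega) (by omega) M hM
    obtain ⟨b₁, b₂⟩ := ih₂ ht G C hG hC _ a₁
    have e₀ : G * (1 + k + k') = G + G * k + G * k' := by ring
    refine ⟨b₁.mono (by omega), fun M' hM' => ?_⟩
    obtain ⟨t₁, c₁, d₁⟩ := a₂ M' (by omega)
    obtain ⟨t₂, c₂, d₂⟩ := b₂ M' (by omega)
    refine ⟨_, .loopTrue hb c₁ c₂, ?_⟩
    have h₁ := b.cost_le (hM.mono (by omega : M ≤ M'))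
    have h₃ := le_mul_succ_sq 1 M'
    have : (1 + b.costCoeff) * (M' + 1) ^ 2 ≤ C * (M' + 1) ^ 2 := by gcongr; omega
    rw [add_mul] at this
    rw [add_mul, add_mul]
    omega
  | @loopFalse b p s hb =>
    intro ht G C hG hC M hM
    simp only [Program.growth, Program.costCoeff, Program.tame] at hG hC ht
    refine ⟨hM.mono (by omega), fun M' hM' => ⟨_, .loopFalse hb, ?_⟩⟩
    have h₁ := b.cost_le (hM.mono (by omega : M ≤ M'))
    have h₃ := le_mul_succ_sq 1 M'
    have : (1 + b.costCoeff) * (M' + 1) ^ 2 ≤ C * (M' + 1) ^ 2 := by gcongr; omega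
    rw [add_mul] at this
    omega

/-- The logarithmic cost of a tame program is polynomial in its number of steps and the sizes of
the numbers in the initial memory. -/
theorem Run.exec {p : Program} {s s' : Memory} {k M : ℕ} (hr : Run p s s' k)
    (hp : p.tame = true) (hM : s.SizeLE M) :
    ∃ t, Exec p s s' t ∧ t ≤ k * (p.costCoeff * (M + p.growth * k + 1) ^ 2) :=
  (hr.exec_aux hp _ _ le_rfl le_rfl M hM).2 _ le_rfl

/-! ### A program logic -/

/-- The registers that a program may write. -/
def Program.regs : Program → List ℕ
  | .skip => []
  | .setReg r _ => [r]
  | .setArr _ _ _ => []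
  | .seq p q => p.regs ++ q.regs
  | .branch _ p q => p.regs ++ q.regs
  | .loop _ p => p.regs

/-- The arrays that a program may write. -/
def Program.arrs : Program → List ℕ
  | .skip => []
  | .setReg _ _ => []
  | .setArr α _ _ => [α]
  | .seq p q => p.arrs ++ q.arrs
  | .branch _ p q => p.arrs ++ q.arrs
  | .loop _ p => p.arrs

/-- The memories differ at most where `p` may write. -/
def Agree (p : Program) (s s' : Memory) : Prop :=
  (∀ r, r ∉ p.regs → s'.reg r = s.reg r) ∧ ∀ α, α ∉ p.arrs → s'.arr α = s.arr α

theorem Agree.refl (p : Program) (s : Memory) : Agree p s s := ⟨fun _ _ => rfl, fun _ _ => rfl⟩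

theorem Agree.trans' {p q u : Program} {s s' s'' : Memory} (h : Agree p s s')
    (h' : Agree q s' s'') (hp : p.regs ⊆ u.regs) (hp' : p.arrs ⊆ u.arrs) (hq : q.regs ⊆ u.regs)
    (hq' : q.arrs ⊆ u.arrs) : Agree u s s'' :=
  ⟨fun r hr => (h'.1 r fun hh => hr (hq hh)).trans (h.1 r fun hh => hr (hp hh)),
    fun r hr => (h'.2 r fun hh => hr (hq' hh)).trans (h.2 r fun hh => hr (hp' hh))⟩

theorem Agree.mono {p u : Program} {s s' : Memory} (h : Agree p s s')
    (hp : p.regs ⊆ u.regs) (hp' : p.arrs ⊆ u.arrs) : Agree u s s' :=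
  h.trans' (Agree.refl p s') hp hp' hp hp'

/-- The frame rule. For a concrete program the written registers and arrays are explicit lists, so
`decide` settles that the remaining cells are preserved. -/
theorem Run.agree {p : Program} {s s' : Memory} {k : ℕ} (h : Run p s s' k) : Agree p s s' := by
  induction h with
  | skip => exact Agree.refl _ _
  | @setReg s r e =>
    exact ⟨fun r' hr => by simp_all [Program.regs], fun _ _ => rfl⟩
  | @setArr s α i e =>
    exact ⟨fun _ _ => rfl,
      fun β hβ => Memory.setArr_arr_of_ne _ _ _ _ _ (by simpa [Program.arrs] using hβ)⟩
  | seq _ _ h₁ h₂ =>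
    exact h₁.trans' h₂ (List.subset_append_left _ _) (List.subset_append_left _ _)
      (List.subset_append_right _ _) (List.subset_append_right _ _)
  | branchTrue _ _ h => exact h.mono (List.subset_append_left _ _) (List.subset_append_left _ _)
  | branchFalse _ _ h =>
    exact h.mono (List.subset_append_right _ _) (List.subset_append_right _ _)
  | loopTrue _ _ _ h₁ h₂ =>
    exact h₁.trans' h₂ (List.Subset.refl _) (List.Subset.refl _) (List.Subset.refl _)
      (List.Subset.refl _)
  | loopFalse _ => exact Agree.refl _ _

/-- Started in memory `s`, the program `p` halts after at most `k` steps, and the final memory has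
the property `Q`. -/
def Halts (p : Program) (s : Memory) (k : ℕ) (Q : Memory → Prop) : Prop :=
  ∃ s' k', k' ≤ k ∧ Run p s s' k' ∧ Q s'

namespace Halts

variable {p q : Program} {s : Memory} {k k' : ℕ} {Q R : Memory → Prop} {b e : Expr}

/-- The rule of consequence with the frame rule built in: postconditions need to mention only what a
program changes. -/
theorem mono (h : Halts p s k Q) (hk : k ≤ k') (hQ : ∀ s', Agree p s s' → Q s' → R s') :
    Halts p s k' R := by
  obtain ⟨s', l, hl, hr, hq⟩ := h
  exact ⟨s', l, hl.trans hk, hr, hQ s' hr.agree hq⟩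

theorem skip (h : Q s) : Halts .skip s 1 Q := ⟨_, 1, le_rfl, .skip, h⟩

theorem setReg {r : ℕ} (h : Q (s.setReg r (e.eval s))) : Halts (.setReg r e) s 1 Q :=
  ⟨_, 1, le_rfl, .setReg, h⟩

theorem setArr {α : ℕ} {i : Expr} (h : Q (s.setArr α (i.eval s) (e.eval s))) :
    Halts (.setArr α i e) s 1 Q :=
  ⟨_, 1, le_rfl, .setArr, h⟩

theorem seq (h : Halts p s k fun s' => Halts q s' k' Q) : Halts (.seq p q) s (1 + k + k') Q := by
  obtain ⟨s', l, hl, hr, s'', l', hl', hr', hq⟩ := h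
  exact ⟨s'', 1 + l + l', by omega, .seq hr hr', hq⟩

theorem branch (h₁ : b.eval s ≠ 0 → Halts p s k Q) (h₂ : b.eval s = 0 → Halts q s k Q) :
    Halts (.branch b p q) s (1 + k) Q := by
  by_cases hb : b.eval s = 0
  · obtain ⟨s', l, hl, hr, hq⟩ := h₂ hb
    exact ⟨s', 1 + l, by omega, .branchFalse hb hr, hq⟩
  · obtain ⟨s', l, hl, hr, hq⟩ := h₁ hb
    exact ⟨s', 1 + l, by omega, .branchTrue hb hr, hq⟩

/-- A loop that terminates because a natural number attached to the state decreases. -/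
theorem loop (Inv : ℕ → Memory → Prop)
    (hstep : ∀ j s', Agree p s s' → Inv j s' → b.eval s' ≠ 0 →
      0 < j ∧ Halts p s' k fun s'' => ∃ j' < j, Inv j' s'')
    (hQ : ∀ j s', Agree p s s' → Inv j s' → b.eval s' = 0 → Q s')
    (j : ℕ) (h₀ : Inv j s) : Halts (.loop b p) s (j * (k + 1) + 1) Q := by
  suffices H : ∀ j s', Agree p s s' → Inv j s' →
      Halts (.loop b p) s' (j * (k + 1) + 1) Q from H j s (Agree.refl _ _) h₀
  intro j
  induction j using Nat.strong_induction_on with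
  | _ j ih =>
    intro s' ha hI
    by_cases hb : b.eval s' = 0
    · exact ⟨s', 1, by omega, .loopFalse hb, hQ j s' ha hI hb⟩
    · obtain ⟨hj, s₁, l₁, hl₁, hr₁, j', hj', hI'⟩ := hstep j s' ha hI hb
      have ha' : Agree p s s₁ := ha.trans' hr₁.agree (List.Subset.refl _) (List.Subset.refl _)
        (List.Subset.refl _) (List.Subset.refl _)
      obtain ⟨s₂, l₂, hl₂, hr₂, hq⟩ := ih j' hj' s₁ ha' hI'
      refine ⟨s₂, 1 + l₁ + l₂, ?_, .loopTrue hb hr₁ hr₂, hq⟩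
      have : (j' + 1) * (k + 1) ≤ j * (k + 1) := Nat.mul_le_mul_right _ hj'
      rw [add_mul] at this
      omega

end Halts

/-- `for r := 0, …, b - 1 do p`. -/
def Program.forLoop (r : ℕ) (b : Expr) (p : Program) : Program :=
  .seq (.setReg r 0) (.loop (.less (.reg r) b) (.seq p (.setReg r (.reg r + 1))))

/-- A round costs the body plus three steps, for the test, the sequencing and the increment. The
bound `b` is evaluated anew in every round, so its value must follow from the invariant and the
frame. The invariant is required after the increment of the counter. -/
theorem Halts.forLoop {r N k : ℕ} {b : Expr} {p : Program} {s : Memory} {Q : Memory → Prop}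
    (Inv : ℕ → Memory → Prop)
    (h₀ : Inv 0 (s.setReg r 0))
    (hb : ∀ j s', Agree (Program.forLoop r b p) s s' → Inv j s' → b.eval s' = N)
    (hstep : ∀ j s', Agree (Program.forLoop r b p) s s' → Inv j s' → s'.reg r = j → j < N →
      Halts p s' k fun s'' => s''.reg r = j ∧ Inv (j + 1) (s''.setReg r (j + 1)))
    (hQ : ∀ s', Agree (Program.forLoop r b p) s s' → Inv N s' → Q s') :
    Halts (Program.forLoop r b p) s (N * (k + 3) + 3) Q := by
  have hag : ∀ s', Agree (.seq p (.setReg r (.reg r + 1))) (s.setReg r 0) s' →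
      Agree (Program.forLoop r b p) s s' := fun s' h =>
    (Run.agree (.setReg (s := s) (r := r) (e := 0))).trans' h
      (by simp [Program.forLoop, Program.regs])
      (by simp [Program.arrs]) (by simp [Program.forLoop, Program.regs])
      (by simp [Program.forLoop, Program.arrs])
  refine (Halts.seq (k := 1) (k' := N * (k + 2 + 1) + 1) (Halts.setReg ?_)).mono
    (by rw [show k + 2 + 1 = k + 3 from rfl]; omega) (fun _ _ h => h)
  refine Halts.loop (fun j s' => s'.reg r + j = N ∧ Inv (s'.reg r) s') ?_ ?_ N ?_
  · intro j s' ha ⟨hj, hI⟩ hlt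
    have hlt' : s'.reg r < b.eval s' := by
      by_contra hcon
      exact hlt (by simp [hcon])
    rw [hb _ s' (hag _ ha) hI] at hlt'
    refine ⟨by omega, (Halts.seq (k := k) (k' := 1)
      ((hstep _ s' (hag _ ha) hI rfl hlt').mono le_rfl ?_)).mono (by omega) (fun _ _ h => h)⟩
    intro s'' _ ⟨h₁, h₂⟩
    refine Halts.setReg ⟨j - 1, by omega, ?_⟩
    simp only [Expr.eval_add, Expr.eval_reg, Expr.eval_one, h₁, Memory.setReg_reg, if_true]
    exact ⟨by omega, h₂⟩
  · intro j s' ha ⟨hj, hI⟩ hlt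
    have hlt' : ¬ s'.reg r < b.eval s' := by
      intro hcon
      simp [hcon] at hlt
    rw [hb _ s' (hag _ ha) hI] at hlt'
    have : s'.reg r = N := by omega
    exact hQ s' (hag _ ha) (this ▸ hI)
  · simpa using h₀

/-! ### A knapsack FPTAS -/

/-- The data of a knapsack problem: item `g` has value `v g` and weight `w g`, it is available if
`t g ≠ 0`, the capacity is `P / Q`. -/
structure KnapsackData where
  v : ℕ → ℕ
  w : ℕ → ℕ
  t : ℕ → ℕ
  P : ℕ
  Q : ℕ

namespace KnapsackData

variable (κ : KnapsackData)

/-- The largest value of one of the first items that is available and fits into the knapsack. -/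
def top : ℕ → ℕ
  | 0 => 0
  | g + 1 => if κ.t g ≠ 0 ∧ κ.Q * κ.w g ≤ κ.P ∧ top g < κ.v g then κ.v g else top g

/-- The dynamic program, for scaled values `u`: the weight and the bit mask of a selection of the
first `g` items with scaled value at least `x` of minimum weight. A weight beyond the capacity means
that there is none. -/
def table (u : ℕ → ℕ) : ℕ → ℕ → ℕ × ℕ
  | 0, x => (if x = 0 then 0 else κ.P + 1, 0)
  | g + 1, x =>
    if κ.t g ≠ 0 ∧ (table u g (x - u g)).1 + κ.w g < (table u g x).1 then
      ((table u g (x - u g)).1 + κ.w g, (table u g (x - u g)).2 + 2 ^ g)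
    else table u g x

/-- The bit mask of the last feasible one of the first `x` entries. -/
def best (f : ℕ → ℕ × ℕ) : ℕ → ℕ
  | 0 => 0
  | x + 1 => if κ.Q * (f x).1 ≤ κ.P then (f x).2 else best f x

/-- The scaled value of item `g` of `m` items, for the accuracy `N / D`. -/
def scaled (m N D g : ℕ) : ℕ := κ.v g * m * D / (N * κ.top m)

/-- A bound for the scaled value of a selection. -/
def scaledBound (m N D : ℕ) : ℕ := m * (m * D / N)

/-- The bit mask of the solution. -/
def mask (m N D : ℕ) : ℕ :=
  κ.best (κ.table (κ.scaled m N D) m) (scaledBound m N D + 1)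

/-- The sum of `f` over the elements of the bit mask `b` among the first `g` items. -/
def bitSum (f : ℕ → ℕ) (b g : ℕ) : ℕ := ∑ i ∈ Finset.range g, if b.testBit i then f i else 0

/-! ### Correctness of the knapsack table and of the rounding. -/

theorem bitSum_succ_of_lt (f : ℕ → ℕ) {b g : ℕ} (hb : b < 2 ^ g) :
    bitSum f b (g + 1) = bitSum f b g := by
  simp [bitSum, Finset.sum_range_succ, Nat.testBit_lt_two_pow hb]

theorem testBit_add_two_pow_self {b g : ℕ} (hb : b < 2 ^ g) : (b + 2 ^ g).testBit g = true := by
  rw [add_comm, Nat.testBit_two_pow_add_eq, Nat.testBit_lt_two_pow hb]; rfl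

theorem testBit_add_two_pow_of_lt {b g i : ℕ} (hi : i < g) :
    (b + 2 ^ g).testBit i = b.testBit i := by
  rw [add_comm, Nat.testBit_two_pow_add_gt hi]

theorem bitSum_succ_add (f : ℕ → ℕ) {b g : ℕ} (hb : b < 2 ^ g) :
    bitSum f (b + 2 ^ g) (g + 1) = bitSum f b g + f g := by
  rw [bitSum, Finset.sum_range_succ, testBit_add_two_pow_self hb, if_pos rfl]
  congr 1
  refine Finset.sum_congr rfl fun i hi => ?_
  rw [testBit_add_two_pow_of_lt (Finset.mem_range.1 hi)]

variable {κ}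

theorem table_snd_lt (u : ℕ → ℕ) (g x : ℕ) : (κ.table u g x).2 < 2 ^ g := by
  induction g generalizing x with
  | zero => simp [table]
  | succ g ih =>
    rw [table]
    split_ifs
    · have := ih (x - u g); rw [pow_succ]; dsimp only; omega
    · have := ih x; rw [pow_succ]; omega

/-- A feasible entry of the table is the weight of a selection that is good enough. -/
theorem table_sound (hQ : 0 < κ.Q) (u : ℕ → ℕ) (g x : ℕ)
    (h : κ.Q * (κ.table u g x).1 ≤ κ.P) :
    (∀ i, (κ.table u g x).2.testBit i = true → κ.t i ≠ 0) ∧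
      bitSum κ.w (κ.table u g x).2 g = (κ.table u g x).1 ∧
      x ≤ bitSum u (κ.table u g x).2 g := by
  induction g generalizing x with
  | zero =>
    rcases Nat.eq_zero_or_pos x with rfl | hx
    · simp [table, bitSum]
    -- The initial weight `P + 1` acts as infinity: since `Q ≥ 1`, it exceeds the capacity `P / Q`.
    · exfalso
      simp only [table, hx.ne', if_false] at h
      nlinarith
  | succ g ih =>
    rw [table] at h ⊢
    split_ifs at h ⊢ with hc
    · have hb := table_snd_lt (κ := κ) u g (x - u g)
      dsimp only at h ⊢
      obtain ⟨h₁, h₂, h₃⟩ := ih (x - u g) (le_trans (Nat.mul_le_mul_left _ (by omega)) h)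
      refine ⟨fun i hi => ?_, ?_, ?_⟩
      · rcases lt_trichotomy i g with hig | rfl | hig
        · exact h₁ i (by rwa [testBit_add_two_pow_of_lt hig] at hi)
        · exact hc.1
        · rw [Nat.testBit_lt_two_pow] at hi
          · simp at hi
          · calc _ < 2 ^ (g + 1) := by rw [pow_succ]; omega
              _ ≤ 2 ^ i := Nat.pow_le_pow_right (by norm_num) hig
      · rw [bitSum_succ_add _ hb, h₂]
      · rw [bitSum_succ_add _ hb]; omega
    · obtain ⟨h₁, h₂, h₃⟩ := ih x h
      have hb := table_snd_lt (κ := κ) u g x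
      exact ⟨h₁, by rwa [bitSum_succ_of_lt _ hb], by rwa [bitSum_succ_of_lt _ hb]⟩

/-- If `S` contains the last item, removing it leaves a competitor for the entry `x - u g`;
otherwise `S` already competes in the previous row. Truncated subtraction fits, because the index is
a lower bound for the scaled value. -/
theorem table_complete (u : ℕ → ℕ) (g : ℕ) (S : Finset ℕ) (hS : S ⊆ Finset.range g)
    (ht : ∀ i ∈ S, κ.t i ≠ 0) (x : ℕ) (hx : x ≤ ∑ i ∈ S, u i) :
    (κ.table u g x).1 ≤ ∑ i ∈ S, κ.w i := by
  induction g generalizing x S with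
  | zero =>
    obtain rfl : S = ∅ := by simpa using hS
    simp_all [table]
  | succ g ih =>
    by_cases hg : g ∈ S
    · have h := ih (S.erase g)
        (fun i hi => by
          have := hS (Finset.mem_of_mem_erase hi)
          have := Finset.ne_of_mem_erase hi
          simp only [Finset.mem_range] at *
          omega)
        (fun i hi => ht i (Finset.mem_of_mem_erase hi)) (x - u g)
        (by rw [← Finset.add_sum_erase _ _ hg] at hx; omega)
      rw [← Finset.add_sum_erase _ _ hg, table]
      split_ifs with hc
      · dsimp only; omega
      · have := ht g hg
        simp only [ne_eq, this, not_false_eq_true, true_and, not_lt] at hc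
        omega
    · have h := ih S
        (fun i hi => by
          have := hS hi
          have : i ≠ g := fun hh => hg (hh ▸ hi)
          simp only [Finset.mem_range] at *
          omega) ht x hx
      rw [table]
      split_ifs with hc
      · dsimp only; omega
      · exact h

/-- Feasibility of entry `0` guarantees that the scan finds something, so the default mask of `best`
is never mistaken for a table entry. -/
theorem best_spec (f : ℕ → ℕ × ℕ) (X : ℕ) (h₀ : κ.Q * (f 0).1 ≤ κ.P) :
    ∃ x ≤ X, κ.Q * (f x).1 ≤ κ.P ∧ κ.best f (X + 1) = (f x).2 ∧
      ∀ y ≤ X, κ.Q * (f y).1 ≤ κ.P → y ≤ x := by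
  induction X with
  | zero => exact ⟨0, le_rfl, h₀, by simp [best, h₀], fun y hy _ => hy⟩
  | succ X ih =>
    by_cases hX : κ.Q * (f (X + 1)).1 ≤ κ.P
    · exact ⟨X + 1, le_rfl, hX, by simp [best, hX], fun y hy _ => hy⟩
    · obtain ⟨x, h₁, h₂, h₃, h₄⟩ := ih
      refine ⟨x, by omega, h₂, by rw [best, if_neg hX, h₃], fun y hy hh => h₄ y ?_ hh⟩
      rcases Nat.lt_or_ge X y with hXy | hXy
      · obtain rfl : y = X + 1 := by omega
        exact absurd hh hX
      · exact hXy

theorem le_top {m g : ℕ} (hg : g < m) (ht : κ.t g ≠ 0) (hw : κ.Q * κ.w g ≤ κ.P) :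
    κ.v g ≤ κ.top m := by
  induction m with
  | zero => omega
  | succ m ih =>
    rw [top]
    rcases Nat.lt_or_ge g m with h | h
    · have := ih h
      split_ifs <;> omega
    · obtain rfl : g = m := by omega
      split_ifs with hc
      · exact le_rfl
      · by_contra hcon
        exact hc ⟨ht, hw, by omega⟩

theorem top_spec (m : ℕ) : κ.top m = 0 ∨
    ∃ g < m, κ.t g ≠ 0 ∧ κ.Q * κ.w g ≤ κ.P ∧ κ.v g = κ.top m := by
  induction m with
  | zero => exact .inl rfl
  | succ m ih =>
    rw [top]
    split_ifs with hc
    · exact .inr ⟨m, by omega, hc.1, hc.2.1, rfl⟩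
    · exact ih.imp_right fun ⟨g, h₁, h₂⟩ => ⟨g, by omega, h₂⟩

theorem le_sum_of_mem {f : ℕ → ℕ} {S : Finset ℕ} {g : ℕ} (hg : g ∈ S) : f g ≤ ∑ i ∈ S, f i :=
  Finset.single_le_sum (fun _ _ => Nat.zero_le _) hg

/-- The solution is feasible, and its scaled value is at least that of any other selection. -/
theorem mask_spec (hQ : 0 < κ.Q) (m N D : ℕ) :
    (∀ i, (κ.mask m N D).testBit i = true → i < m ∧ κ.t i ≠ 0) ∧
      κ.Q * bitSum κ.w (κ.mask m N D) m ≤ κ.P ∧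
      ∀ S ⊆ Finset.range m, (∀ i ∈ S, κ.t i ≠ 0) → κ.Q * ∑ i ∈ S, κ.w i ≤ κ.P →
        ∑ i ∈ S, κ.scaled m N D i ≤ bitSum (κ.scaled m N D) (κ.mask m N D) m := by
  -- The empty selection witnesses entry `0`.
  have h₀ : κ.Q * (κ.table (κ.scaled m N D) m 0).1 ≤ κ.P := by
    have := table_complete (κ := κ) (κ.scaled m N D) m ∅ (by simp) (by simp) 0 (by simp)
    simp only [Finset.sum_empty, Nat.le_zero] at this
    simp [this]
  obtain ⟨x, h₁, h₂, h₃, h₄⟩ :=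
    best_spec (κ.table (κ.scaled m N D) m) (scaledBound m N D) h₀
  obtain ⟨a₁, a₂, a₃⟩ := table_sound hQ _ _ _ h₂
  rw [mask, h₃]
  refine ⟨fun i hi => ⟨?_, a₁ i hi⟩, by rwa [a₂], fun S hS ht hw => ?_⟩
  · by_contra hcon
    rw [Nat.testBit_lt_two_pow ((table_snd_lt _ _ _).trans_le
      (Nat.pow_le_pow_right (by norm_num) (not_lt.1 hcon)))] at hi
    simp at hi
  · refine (h₄ _ ?_ ?_).trans a₃
    -- The table is long enough: an item of a feasible selection has value at most `top`, hence
    -- scaled value at most `m * D / N`. If `top = 0`, division by zero makes all scaled values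
    -- zero.
    · calc _ ≤ ∑ i ∈ S, m * D / N := by
            refine Finset.sum_le_sum fun i hi => ?_
            have hv : κ.v i ≤ κ.top m := le_top (Finset.mem_range.1 (hS hi)) (ht i hi)
              (le_trans (Nat.mul_le_mul_left _ (le_sum_of_mem hi)) hw)
            rcases Nat.eq_zero_or_pos (κ.top m) with h0 | h0
            · simp [scaled, h0]
            · calc κ.scaled m N D i ≤ m * D * κ.top m / (N * κ.top m) :=
                    Nat.div_le_div_right (by rw [mul_assoc, mul_comm]; gcongr)
                _ = _ := Nat.mul_div_mul_right _ _ h0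
        _ ≤ _ := by
            rw [Finset.sum_const, smul_eq_mul]
            exact Nat.mul_le_mul_right _ (by simpa using Finset.card_le_card hS)
    · exact (Nat.mul_le_mul_left _ (table_complete _ _ S hS ht _ le_rfl)).trans hw

/-- The rounding argument, cleared of denominators: one unit of scaled value is worth `N * top / (m
* D)`. The solution is worth at least its scaled value, and `S` exceeds its own scaled value by at
most `m` units, that is, by `N / D * top ≤ N / D * v(S)`. -/
theorem mask_approx_of_top_le (hQ : 0 < κ.Q) {m N D : ℕ} (hN : 0 < N) (hD : 0 < D)
    {S : Finset ℕ} (hS : S ⊆ Finset.range m) (ht : ∀ i ∈ S, κ.t i ≠ 0)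
    (hw : κ.Q * ∑ i ∈ S, κ.w i ≤ κ.P) (hv : κ.top m ≤ ∑ i ∈ S, κ.v i) :
    (1 - (N : ℚ) / D) * (∑ i ∈ S, κ.v i : ℕ) ≤ (bitSum κ.v (κ.mask m N D) m : ℕ) := by
  obtain ⟨_, _, h⟩ := mask_spec hQ m N D
  have h := h S hS ht hw
  rcases Nat.eq_zero_or_pos (∑ i ∈ S, κ.v i) with h0 | h0
  · rw [h0]; simp
  have hm : 0 < m := by
    rcases Nat.eq_zero_or_pos m with rfl | hm
    · obtain rfl : S = ∅ := by simpa using hS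
      simp at h0
    · exact hm
  have htop : 0 < κ.top m := by
    obtain ⟨i, hi, hne⟩ := Finset.exists_ne_zero_of_sum_ne_zero h0.ne'
    exact (Nat.pos_of_ne_zero hne).trans_le (le_top (Finset.mem_range.1 (hS hi)) (ht i hi)
      (le_trans (Nat.mul_le_mul_left _ (le_sum_of_mem hi)) hw))
  set T := κ.top m
  have hNT : 0 < N * T := Nat.mul_pos hN htop
  -- upper bound for the solution
  have h₁ : N * T * bitSum (κ.scaled m N D) (κ.mask m N D) m
      ≤ m * D * bitSum κ.v (κ.mask m N D) m := by
    rw [bitSum, bitSum, Finset.mul_sum, Finset.mul_sum]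
    refine Finset.sum_le_sum fun i _ => ?_
    split_ifs
    · calc _ ≤ κ.v i * m * D := Nat.mul_div_le _ _
        _ = _ := by ring
    · simp
  -- Rounding down loses less than one unit for each of the at most `m` items.
  have h₂ : m * D * ∑ i ∈ S, κ.v i ≤ N * T * ∑ i ∈ S, κ.scaled m N D i + m * (N * T) := by
    have hc : ∑ i ∈ S, N * T ≤ m * (N * T) := by
      rw [Finset.sum_const, smul_eq_mul]
      exact Nat.mul_le_mul_right _ (by simpa using Finset.card_le_card hS)
    refine le_trans ?_ (Nat.add_le_add_left hc _)
    rw [Finset.mul_sum, Finset.mul_sum, ← Finset.sum_add_distrib]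
    refine Finset.sum_le_sum fun i _ => ?_
    calc m * D * κ.v i = κ.v i * m * D := by ring
      _ ≤ _ := (Nat.lt_mul_div_succ (κ.v i * m * D) hNT).le
      _ = _ := by rw [scaled]; ring
  -- The scaled optimality of the solution and `T ≤ v(S)` enter here.
  have h₃ : m * D * ∑ i ∈ S, κ.v i
      ≤ m * D * bitSum κ.v (κ.mask m N D) m + m * (N * ∑ i ∈ S, κ.v i) :=
    calc _ ≤ _ := h₂
      _ ≤ N * T * bitSum (κ.scaled m N D) (κ.mask m N D) m + m * (N * T) := by gcongr
      _ ≤ _ := by gcongr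
  have h₄ : D * ∑ i ∈ S, κ.v i ≤ D * bitSum κ.v (κ.mask m N D) m + N * ∑ i ∈ S, κ.v i := by
    refine Nat.le_of_mul_le_mul_left ?_ hm
    rw [mul_add, ← mul_assoc, ← mul_assoc]; exact h₃
  have h₅ : (D : ℚ) * (∑ i ∈ S, κ.v i : ℕ)
      ≤ D * (bitSum κ.v (κ.mask m N D) m : ℕ) + N * (∑ i ∈ S, κ.v i : ℕ) := by
    exact_mod_cast h₄
  have hD' : (0 : ℚ) < D := by exact_mod_cast hD
  refine le_of_mul_le_mul_left ?_ hD'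
  calc (D : ℚ) * ((1 - (N : ℚ) / D) * (∑ i ∈ S, κ.v i : ℕ))
      = D * (∑ i ∈ S, κ.v i : ℕ) - N * (∑ i ∈ S, κ.v i : ℕ) := by field_simp
    _ ≤ _ := by linarith

/-- A selection worth less than `top` is compared with the single item of value `top` instead, for
which the rounding argument applies. -/
theorem mask_approx (hQ : 0 < κ.Q) {m N D : ℕ} (hN : 0 < N) (hD : 0 < D) (hND : N ≤ D)
    {S : Finset ℕ} (hS : S ⊆ Finset.range m) (ht : ∀ i ∈ S, κ.t i ≠ 0)
    (hw : κ.Q * ∑ i ∈ S, κ.w i ≤ κ.P) :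
    (1 - (N : ℚ) / D) * (∑ i ∈ S, κ.v i : ℕ) ≤ (bitSum κ.v (κ.mask m N D) m : ℕ) := by
  rcases le_total (κ.top m) (∑ i ∈ S, κ.v i) with hv | hv
  · exact mask_approx_of_top_le hQ hN hD hS ht hw hv
  · rcases κ.top_spec m with h0 | ⟨g, hg, htg, hwg, hvg⟩
    · exact mask_approx_of_top_le hQ hN hD hS ht hw (by omega)
    · have h := mask_approx_of_top_le (κ := κ) hQ hN hD (S := {g}) (m := m) (by simpa using hg)
        (by simpa using htg) (by simpa using hwg) (by simp [hvg])
      refine le_trans ?_ h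
      rw [Finset.sum_singleton, hvg]
      have : (N : ℚ) / D ≤ 1 := by
        rw [div_le_one (by exact_mod_cast hD)]
        exact_mod_cast hND
      have : (0 : ℚ) ≤ 1 - N / D := by linarith
      gcongr

/-- The solution depends only on the ratio `N / D`. -/
theorem mask_congr {m N D N' D' : ℕ} (hN : 0 < N) (hN' : 0 < N') (h : N * D' = N' * D) :
    κ.mask m N D = κ.mask m N' D' := by
  -- Each fraction is expanded by the numerator of the other accuracy.
  have key : ∀ a b : ℕ, a * D / (N * b) = a * D' / (N' * b) := fun a b => by
    rw [← Nat.mul_div_mul_left _ _ hN', ← Nat.mul_div_mul_left (a * D') _ hN]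
    congr 1
    · calc N' * (a * D) = a * (N' * D) := by ring
        _ = N * (a * D') := by rw [← h]; ring
    · ring
  have h₁ : κ.scaled m N D = κ.scaled m N' D' := funext fun g => key _ _
  have h₂ : scaledBound m N D = scaledBound m N' D' := by
    have := key m 1
    rw [mul_one, mul_one] at this
    rw [scaledBound, this, scaledBound]
  rw [mask, mask, h₁, h₂]

end KnapsackData

/-- The data of the knapsack problem of a knapsack routine. -/
def knapsackData {m : ℕ} (v w : Fin m → ℕ) (T : Finset (Fin m)) (W : ℚ≥0) : KnapsackData where
  v := ofVector v
  w := ofVector w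
  t := ofVector fun g => if g ∈ T then 1 else 0
  P := W.num
  Q := W.den

/-- The dynamic programming routine for the knapsack problem. -/
def dpKnapsack : KnapsackRoutine := fun m v w T W δ =>
  Finset.univ.filter fun g =>
    ((knapsackData v w T W).mask m δ.num.natAbs δ.den).testBit g = true

/-! ### The dynamic program as an approximate knapsack routine. -/

theorem ofVector_fin {n : ℕ} (f : Fin n → ℕ) (i : Fin n) : ofVector f i = f i := by
  simp [ofVector]

theorem ofVector_lt {n : ℕ} (f : Fin n → ℕ) {i : ℕ} (h : i < n) : ofVector f i = f ⟨i, h⟩ := by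
  simp [ofVector, h]

theorem sum_image_ofVector {m : ℕ} (f : Fin m → ℕ) (S : Finset (Fin m)) :
    ∑ i ∈ S.image Fin.val, ofVector f i = ∑ g ∈ S, f g := by
  rw [Finset.sum_image (fun _ _ _ _ h => Fin.ext h)]
  exact Finset.sum_congr rfl fun g _ => ofVector_fin f g

theorem sum_filter_testBit {m : ℕ} (f : Fin m → ℕ) (b : ℕ) :
    ∑ g ∈ Finset.univ.filter (fun g : Fin m => b.testBit g = true), f g
      = KnapsackData.bitSum (ofVector f) b m := by
  rw [KnapsackData.bitSum, ← Fin.sum_univ_eq_sum_range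
    (fun i => if b.testBit i = true then ofVector f i else 0), Finset.sum_filter]
  simp [ofVector_fin]

theorem capacity_iff (W : ℚ≥0) (x : ℕ) : (x : ℚ) ≤ W ↔ W.den * x ≤ W.num := by
  have h : (W : ℚ) = W.num / W.den := by
    conv_lhs => rw [← NNRat.num_div_den W]
    push_cast
    rfl
  have hd : (0 : ℚ) < W.den := by exact_mod_cast W.den_pos
  rw [h, le_div_iff₀ hd, mul_comm]
  exact_mod_cast Iff.rfl

theorem natAbs_num_div_den {δ : ℚ} (h : 0 < δ) : (δ.num.natAbs : ℚ) / δ.den = δ := by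
  have : ((δ.num.natAbs : ℤ) : ℚ) = δ.num := by
    rw [Int.natAbs_of_nonneg (Rat.num_nonneg.2 h.le)]
  rw [← Int.cast_natCast, this, Rat.num_div_den]

theorem natAbs_num_pos {δ : ℚ} (h : 0 < δ) : 0 < δ.num.natAbs :=
  Int.natAbs_pos.2 (Rat.num_pos.2 h).ne'

theorem dpKnapsack_isApproximate : dpKnapsack.IsApproximate := by
  intro m v w T W δ hδ hδ'
  set κ := knapsackData v w T W with hκ
  have hQ : 0 < κ.Q := W.den_pos
  obtain ⟨h₁, h₂, _⟩ := KnapsackData.mask_spec hQ m δ.num.natAbs δ.den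
  refine ⟨fun g hg => ?_, ?_, fun S hS hSw => ?_⟩
  · have := (h₁ g (Finset.mem_filter.1 hg).2).2
    by_contra hcon
    simp [hκ, knapsackData, ofVector_fin, hcon] at this
  · rw [← Nat.cast_sum, capacity_iff, dpKnapsack, sum_filter_testBit]
    exact h₂
  · rw [← Nat.cast_sum, capacity_iff] at hSw
    have hδ₁ := natAbs_num_div_den hδ
    have hd : (0 : ℚ) < δ.den := by exact_mod_cast δ.den_pos
    have h := KnapsackData.mask_approx (κ := κ) hQ (m := m) (natAbs_num_pos hδ) δ.den_pos
      (by
        rw [← hδ₁, div_le_one hd] at hδ'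
        exact_mod_cast hδ')
      (S := S.image Fin.val) (fun i hi => by
        obtain ⟨g, _, rfl⟩ := Finset.mem_image.1 hi
        simp)
      (fun i hi => by
        obtain ⟨g, hg, rfl⟩ := Finset.mem_image.1 hi
        simp [hκ, knapsackData, ofVector_fin, hS hg])
      (by rw [hκ]; simp only [knapsackData]; rwa [sum_image_ofVector])
    rw [hδ₁] at h
    simp only [hκ, knapsackData, sum_image_ofVector] at h
    rw [← Nat.cast_sum, ← Nat.cast_sum, dpKnapsack, sum_filter_testBit]
    exact h

section DynamicProgram

open FairDivision.Expr (reg arr)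

local infixr:60 " ;; " => Program.seq

/-! ### The dynamic program

Input: the registers `10, …, 14` hold the number of items, the numerator and denominator of the
capacity, and the numerator and denominator of the accuracy, the arrays `10, 11, 12` hold values,
weights and availability. Output: array `13` holds the indicator vector of the solution, and register
`25` its value. -/

/-- The input of the dynamic program is as stated. -/
structure DPInput (κ : KnapsackData) (m N D : ℕ) (s : Memory) : Prop where
  regM : s.reg 10 = m
  regP : s.reg 11 = κ.P
  regQ : s.reg 12 = κ.Q
  regN : s.reg 13 = N
  regD : s.reg 14 = D
  arrV : ∀ g < m, s.arr 10 g = κ.v g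
  arrW : ∀ g < m, s.arr 11 g = κ.w g
  arrT : ∀ g < m, s.arr 12 g = κ.t g

theorem DPInput.agree {κ : KnapsackData} {m N D : ℕ} {s s' : Memory} {p : Program}
    (h : DPInput κ m N D s) (ha : Agree p s s')
    (hp : (10 ∉ p.regs ∧ 11 ∉ p.regs ∧ 12 ∉ p.regs ∧ 13 ∉ p.regs ∧ 14 ∉ p.regs) ∧
      10 ∉ p.arrs ∧ 11 ∉ p.arrs ∧ 12 ∉ p.arrs) : DPInput κ m N D s' := by
  obtain ⟨⟨a, b, c, d, e⟩, x, y, z⟩ := hp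
  constructor
  · rw [ha.1 _ a, h.regM]
  · rw [ha.1 _ b, h.regP]
  · rw [ha.1 _ c, h.regQ]
  · rw [ha.1 _ d, h.regN]
  · rw [ha.1 _ e, h.regD]
  · intro g hg; rw [ha.2 _ x, h.arrV g hg]
  · intro g hg; rw [ha.2 _ y, h.arrW g hg]
  · intro g hg; rw [ha.2 _ z, h.arrT g hg]

/-- Products of truth values serve as conjunctions, and `1 - .less x y` expresses `y ≤ x`. -/
def topProgram : Program :=
  .setReg 22 0 ;;
  .forLoop 20 (reg 10)
    (.branch
      (arr 12 (reg 20) * (1 - .less (reg 11) (reg 12 * arr 11 (reg 20))) * .less (reg 22) (arr 10 (reg 20)))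
      (.setReg 22 (arr 10 (reg 20)))
      .skip)

/-- The bound for the scaled value of a selection. -/
def boundExpr : Expr := reg 10 * (reg 10 * reg 14 / reg 13)

/-- The scaled value of the current item. -/
def scaledExpr : Expr := arr 10 (reg 20) * reg 10 * reg 14 / (reg 13 * reg 22)

/-- The current entry of the table. -/
def entryExpr : Expr := boundExpr - reg 21

/-- The bound of the loop is an expression that is evaluated again in each round, and is not kept in
a register: storing a product would violate tameness. -/
def initProgram : Program :=
  .forLoop 21 (boundExpr + 1) (.setArr 14 (reg 21) (reg 11 + 1) ;; .setArr 15 (reg 21) 0) ;;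
  .setArr 14 0 0

/-- The row is updated in place. Entries are visited from the largest index downwards, since an
entry depends on old entries of smaller or equal index. -/
def rowProgram : Program :=
  .forLoop 21 (boundExpr + 1)
    (.branch
      (.less (arr 14 (entryExpr - scaledExpr) + arr 11 (reg 20)) (arr 14 entryExpr))
      (.setArr 15 entryExpr (arr 15 (entryExpr - scaledExpr) + reg 23) ;;
        .setArr 14 entryExpr (arr 14 (entryExpr - scaledExpr) + arr 11 (reg 20)))
      .skip)

/-- Register `23` holds the bit `2 ^ g` of the current item; doubling by addition keeps the program
tame. -/
def tableProgram : Program :=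
  .setReg 23 1 ;;
  .forLoop 20 (reg 10)
    (.branch (arr 12 (reg 20)) rowProgram .skip ;; .setReg 23 (reg 23 + reg 23))

def bestProgram : Program :=
  .setReg 24 0 ;;
  .forLoop 21 (boundExpr + 1)
    (.branch (.less (reg 11) (reg 12 * arr 14 (reg 21))) .skip (.setReg 24 (arr 15 (reg 21))))

/-- The lowest bit of `b` is recognised by `b / 2 + b / 2 < b`. -/
def decodeProgram : Program :=
  .setReg 25 0 ;;
  .forLoop 20 (reg 10)
    (.setArr 13 (reg 20) (.less (reg 24 / 2 + reg 24 / 2) (reg 24)) ;;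
      .branch (arr 13 (reg 20)) (.setReg 25 (reg 25 + arr 10 (reg 20))) .skip ;;
      .setReg 24 (reg 24 / 2))

def dpProgram : Program :=
  topProgram ;; initProgram ;; tableProgram ;; bestProgram ;; decodeProgram

/-! ### Correctness and step counts of the dynamic program. -/

variable {κ : KnapsackData} {m N D : ℕ} {s : Memory}

theorem topProgram_halts (h : DPInput κ m N D s) :
    Halts topProgram s (m * 5 + 5) fun s' => s'.reg 22 = κ.top m := by
  refine (Halts.seq (k := 1) (k' := m * 5 + 3) (Halts.setReg ?_)).mono (by omega)
    (fun _ _ h => h)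
  refine Halts.forLoop (k := 2) (fun j s' => s'.reg 22 = κ.top j) (by simp [KnapsackData.top])
    ?_ ?_ (fun s' _ h => h)
  · intro j s' ha _
    simpa using (ha.1 10 (by decide)).trans h.regM
  · intro j s' ha hI hj hlt
    have h' : DPInput κ m N D s' := (h.agree (Run.setReg).agree (by decide)).agree ha (by decide)
    have hcond : Expr.eval s' (arr 12 (reg 20) * (1 - .less (reg 11) (reg 12 * arr 11 (reg 20)))
        * .less (reg 22) (arr 10 (reg 20))) ≠ 0 ↔
        κ.t j ≠ 0 ∧ κ.Q * κ.w j ≤ κ.P ∧ κ.top j < κ.v j := by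
      simp only [Expr.eval_mul, Expr.eval_arr, Expr.eval_reg, Expr.eval_sub, Expr.eval_one,
        Expr.eval_less, hj, h'.regP, h'.regQ, h'.arrV j hlt, h'.arrW j hlt, h'.arrT j hlt, hI]
      split_ifs <;> simp <;> omega
    refine Halts.branch (k := 1) (fun hb => Halts.setReg ?_) (fun hb => Halts.skip ?_)
    · rw [hcond] at hb
      simp [hj, h'.arrV j hlt, KnapsackData.top, hb]
    · have := mt hcond.2 (not_not.2 hb)
      simp only [hj, Memory.setReg_reg, KnapsackData.top, if_neg this, true_and]
      simpa using hI

theorem boundExpr_eval (h : DPInput κ m N D s) :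
    boundExpr.eval s = KnapsackData.scaledBound m N D := by
  simp [boundExpr, KnapsackData.scaledBound, h.regM, h.regN, h.regD]

theorem scaledExpr_eval (h : DPInput κ m N D s) {g : ℕ} (hg : s.reg 20 = g) (hgm : g < m)
    (htop : s.reg 22 = κ.top m) : scaledExpr.eval s = κ.scaled m N D g := by
  simp [scaledExpr, KnapsackData.scaled, h.regM, h.regN, h.regD, hg, h.arrV g hgm, htop]

/-- The arrays `14` and `15` hold the entries `x ≤ X` of the table `f`. -/
def TableAt (f : ℕ → ℕ × ℕ) (X : ℕ) (s : Memory) : Prop :=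
  ∀ x ≤ X, s.arr 14 x = (f x).1 ∧ s.arr 15 x = (f x).2

theorem initProgram_halts (h : DPInput κ m N D s) (u : ℕ → ℕ) :
    Halts initProgram s (KnapsackData.scaledBound m N D * 6 + 11) fun s' =>
      TableAt (κ.table u 0) (KnapsackData.scaledBound m N D) s' := by
  set X := KnapsackData.scaledBound m N D with hX
  refine (Halts.seq (k := (X + 1) * 6 + 3) (k' := 1) ?_).mono (by omega) (fun _ _ h => h)
  refine Halts.forLoop (k := 3)
    (fun j s' => ∀ x < j, s'.arr 14 x = κ.P + 1 ∧ s'.arr 15 x = 0) (by simp) ?_ ?_ ?_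
  · intro j s' ha _
    simp [boundExpr_eval (h.agree ha (by decide)), hX]
  · intro j s' ha hI hj hlt
    have h' : DPInput κ m N D s' := h.agree ha (by decide)
    refine Halts.seq (k := 1) (k' := 1) (Halts.setArr (Halts.setArr ?_))
    simp only [Expr.eval_add, Expr.eval_reg, Expr.eval_one, Expr.eval_zero, h'.regP, hj,
      Memory.setArr_reg, Memory.setReg_arr, Memory.setArr_arr, true_and]
    intro x hx
    rcases eq_or_ne x j with rfl | hne
    · simp
    · simpa [hne] using hI x (by omega)
  · intro s' ha hI
    refine Halts.setArr fun x hx => ?_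
    rcases eq_or_ne x 0 with rfl | hne
    · simpa [KnapsackData.table] using (hI 0 (by omega)).2
    · simpa [KnapsackData.table, hne] using hI x (by omega)

/-- After `j` rounds precisely the last `j` entries belong to the new row; `X < x + j` says this
without truncated subtraction. -/
theorem rowProgram_halts (h : DPInput κ m N D s) {g : ℕ} (hgm : g < m) (ht : κ.t g ≠ 0)
    (hg : s.reg 20 = g) (htop : s.reg 22 = κ.top m) (hpow : s.reg 23 = 2 ^ g)
    (htab : TableAt (κ.table (κ.scaled m N D) g) (KnapsackData.scaledBound m N D) s) :
    Halts rowProgram s (KnapsackData.scaledBound m N D * 7 + 10) fun s' =>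
      TableAt (κ.table (κ.scaled m N D) (g + 1)) (KnapsackData.scaledBound m N D) s' := by
  set X := KnapsackData.scaledBound m N D with hX
  set u := κ.scaled m N D with hu
  refine (Halts.forLoop (N := X + 1) (k := 4)
    (fun j s' => ∀ x ≤ X,
      s'.arr 14 x = (if X < x + j then κ.table u (g + 1) x else κ.table u g x).1 ∧
      s'.arr 15 x = (if X < x + j then κ.table u (g + 1) x else κ.table u g x).2)
    ?_ ?_ ?_ ?_).mono (by omega) (fun _ _ h => h)
  · intro x hx
    simpa [not_lt.2 hx] using htab x hx
  · intro j s' ha _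
    simp [boundExpr_eval (h.agree ha (by decide)), hX]
  · intro j s' ha hI hj hlt
    have h' : DPInput κ m N D s' := h.agree ha (by decide)
    have h20 : s'.reg 20 = g := (ha.1 20 (by decide)).trans hg
    have h22 : s'.reg 22 = κ.top m := (ha.1 22 (by decide)).trans htop
    have h23 : s'.reg 23 = 2 ^ g := (ha.1 23 (by decide)).trans hpow
    have hx : entryExpr.eval s' = X - j := by simp [entryExpr, boundExpr_eval h', hj, hX]
    have hsc : scaledExpr.eval s' = u g := scaledExpr_eval h' h20 hgm h22
    -- Entries up to `X - j` are not yet overwritten, so both lookups see the old row.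
    have hcur := hI (X - j) (by omega)
    have hprev := hI (X - j - u g) (by omega)
    rw [if_neg (by omega)] at hcur hprev
    have hnext : ∀ x ≤ X, x ≠ X - j → (X < x + (j + 1) ↔ X < x + j) := by omega
    refine Halts.branch (k := 3) (fun hb => ?_)
      (fun hb => (Halts.skip ?_).mono (by norm_num) (fun _ _ h => h))
    · have hcond : (κ.table u g (X - j - u g)).1 + κ.w g < (κ.table u g (X - j)).1 := by
        by_contra hcon
        simp [hx, hsc, hcur, hprev, h20, h'.arrW g hgm, hcon] at hb
      have hu0 : X - j - u g ≠ X - j := by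
        intro hcon
        rw [hcon] at hcond
        omega
      refine Halts.seq (k := 1) (k' := 1) (Halts.setArr (Halts.setArr ?_))
      have hx' : ∀ i y, entryExpr.eval (s'.setArr 15 i y) = X - j := fun i y => hx
      have hsc' : ∀ i y, scaledExpr.eval (s'.setArr 15 i y) = u g := fun i y => by
        rw [← hsc]; simp [scaledExpr]
      simp only [Expr.eval_add, Expr.eval_arr, Expr.eval_sub, Expr.eval_reg, hx, hx', hsc, hsc',
        Memory.setArr_reg, Memory.setArr_arr, Memory.setReg_arr, hj, true_and, hprev, h20, h23,
        h'.arrW g hgm]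
      intro x hxX
      rcases eq_or_ne x (X - j) with rfl | hne
      · have hnew : κ.table u (g + 1) (X - j) = ((κ.table u g (X - j - u g)).1 + κ.w g,
            (κ.table u g (X - j - u g)).2 + 2 ^ g) := by
          rw [KnapsackData.table, if_pos ⟨ht, hcond⟩]
        have hlast : X < X - j + (j + 1) := by omega
        simp [hnew, hlast]
      · have := hI x hxX
        simp only [hne, and_false, if_false, hnext x hxX hne]
        exact this
    · have hcond : ¬ (κ.table u g (X - j - u g)).1 + κ.w g < (κ.table u g (X - j)).1 := by
        intro hcon
        simp [hx, hsc, hcur, hprev, h20, h'.arrW g hgm, hcon] at hb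
      refine ⟨hj, fun x hxX => ?_⟩
      rcases eq_or_ne x (X - j) with rfl | hne
      · rw [if_pos (by omega), KnapsackData.table, if_neg (fun hh => hcond hh.2)]
        exact hcur
      · rw [Memory.setReg_arr]
        simp only [hnext x hxX hne]
        exact hI x hxX
  · intro s' ha hI x hx
    simpa [show X < x + (X + 1) from by omega] using hI x hx

theorem tableProgram_halts (h : DPInput κ m N D s) (htop : s.reg 22 = κ.top m)
    (htab : TableAt (κ.table (κ.scaled m N D) 0) (KnapsackData.scaledBound m N D) s) :
    Halts tableProgram s (m * (KnapsackData.scaledBound m N D * 7 + 16) + 5) fun s' =>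
      TableAt (κ.table (κ.scaled m N D) m) (KnapsackData.scaledBound m N D) s' := by
  set X := KnapsackData.scaledBound m N D with hX
  refine (Halts.seq (k := 1) (k' := m * (X * 7 + 13 + 3) + 3) (Halts.setReg ?_)).mono
    (by rw [show X * 7 + 13 + 3 = X * 7 + 16 from rfl]; omega) (fun _ _ h => h)
  refine Halts.forLoop (k := X * 7 + 13)
    (fun j s' => s'.reg 23 = 2 ^ j ∧ TableAt (κ.table (κ.scaled m N D) j) X s')
    ⟨by simp, by exact htab⟩ ?_ ?_ (fun s' _ h => h.2)
  · intro j s' ha _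
    simpa using (ha.1 10 (by decide)).trans h.regM
  · intro j s' ha hI hj hlt
    have h' : DPInput κ m N D s' := (h.agree (Run.setReg).agree (by decide)).agree ha (by decide)
    have h22 : s'.reg 22 = κ.top m := (ha.1 22 (by decide)).trans (by simpa using htop)
    refine (Halts.seq (k := 1 + (X * 7 + 10)) (k' := 1) ?_).mono (by omega) (fun _ _ h => h)
    refine (Halts.branch
      (Q := fun s'' => TableAt (κ.table (κ.scaled m N D) (j + 1)) X s'') (fun hb => ?_)
      (fun hb => ?_)).mono le_rfl (fun s'' ha' hs'' => Halts.setReg ?_)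
    · have ht : κ.t j ≠ 0 := by simpa [hj, h'.arrT j hlt] using hb
      exact rowProgram_halts h' hlt ht hj h22 hI.1 hI.2
    · have ht : κ.t j = 0 := by simpa [hj, h'.arrT j hlt] using hb
      refine (Halts.skip ?_).mono (by omega) (fun _ _ h => h)
      intro x hx
      rw [KnapsackData.table, if_neg (fun hh => hh.1 ht)]
      exact hI.2 x hx
    · have h20 : s''.reg 20 = j := (ha'.1 20 (by decide)).trans hj
      have h23 : s''.reg 23 = 2 ^ j := (ha'.1 23 (by decide)).trans hI.1
      refine ⟨by simpa using h20, ?_, hs''⟩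
      simp [h23, pow_succ, mul_two]

theorem bestProgram_halts (h : DPInput κ m N D s) (f : ℕ → ℕ × ℕ)
    (htab : TableAt f (KnapsackData.scaledBound m N D) s) :
    Halts bestProgram s (KnapsackData.scaledBound m N D * 5 + 10) fun s' =>
      s'.reg 24 = κ.best f (KnapsackData.scaledBound m N D + 1) := by
  set X := KnapsackData.scaledBound m N D with hX
  refine (Halts.seq (k := 1) (k' := (X + 1) * 5 + 3) (Halts.setReg ?_)).mono (by omega)
    (fun _ _ h => h)
  refine Halts.forLoop (k := 2) (fun j s' => s'.reg 24 = κ.best f j)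
    (by simp [KnapsackData.best]) ?_ ?_ (fun s' _ h => h)
  · intro j s' ha _
    simp [boundExpr_eval ((h.agree (Run.setReg).agree (by decide)).agree ha (by decide)), hX]
  · intro j s' ha hI hj hlt
    have h' : DPInput κ m N D s' := (h.agree (Run.setReg).agree (by decide)).agree ha (by decide)
    have h14 : s'.arr 14 j = (f j).1 := by
      rw [ha.2 14 (by decide)]; exact (htab j (by omega)).1
    have h15 : s'.arr 15 j = (f j).2 := by
      rw [ha.2 15 (by decide)]; exact (htab j (by omega)).2
    have hcond : Expr.eval s' (.less (reg 11) (reg 12 * arr 14 (reg 21))) = 0 ↔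
        κ.Q * (f j).1 ≤ κ.P := by
      simp [hj, h'.regP, h'.regQ, h14]
    refine Halts.branch (k := 1) (fun hb => Halts.skip ?_) (fun hb => Halts.setReg ?_)
    · rw [Ne, hcond] at hb
      simp [hj, KnapsackData.best, hb, hI]
    · rw [hcond] at hb
      simp [hj, KnapsackData.best, hb, h15]

theorem decodeProgram_halts (h : DPInput κ m N D s) {b : ℕ} (hb : s.reg 24 = b) :
    Halts decodeProgram s (m * 9 + 5) fun s' =>
      (∀ g < m, s'.arr 13 g = if b.testBit g = true then 1 else 0) ∧
      s'.reg 25 = KnapsackData.bitSum κ.v b m := by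
  refine (Halts.seq (k := 1) (k' := m * 9 + 3) (Halts.setReg ?_)).mono (by omega)
    (fun _ _ h => h)
  refine Halts.forLoop (k := 6) (fun j s' => s'.reg 24 = b / 2 ^ j ∧
      (∀ g < j, s'.arr 13 g = if b.testBit g = true then 1 else 0) ∧
      s'.reg 25 = KnapsackData.bitSum κ.v b j)
    (by simp [hb, KnapsackData.bitSum]) ?_ ?_ (fun s' _ h => h.2)
  · intro j s' ha _
    simpa using (ha.1 10 (by decide)).trans h.regM
  · intro j s' ha ⟨h24, h13, h25⟩ hj hlt
    have h' : DPInput κ m N D s' := (h.agree (Run.setReg).agree (by decide)).agree ha (by decide)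
    have hbit : (if b / 2 ^ j / 2 + b / 2 ^ j / 2 < b / 2 ^ j then 1 else 0) =
        if b.testBit j = true then 1 else 0 := by
      have : b.testBit j = true ↔ b / 2 ^ j / 2 + b / 2 ^ j / 2 < b / 2 ^ j := by
        rw [Nat.testBit_eq_decide_div_mod_eq, decide_eq_true_eq]; omega
      simp only [this]
    refine (Halts.seq (k := 1) (k' := 4) (Halts.setArr ?_)).mono (by omega) (fun _ _ h => h)
    simp only [Expr.eval_less, Expr.eval_add, Expr.eval_div, Expr.eval_reg, Expr.eval_two, h24,
      hbit, hj]
    refine (Halts.seq (k := 2) (k' := 1) ?_).mono (by omega) (fun _ _ h => h)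
    have hfin : ∀ s'' : Memory, s''.reg 20 = j → s''.reg 24 = b / 2 ^ j →
        s''.arr 13 = (s'.setArr 13 j (if b.testBit j = true then 1 else 0)).arr 13 →
        s''.reg 25 = KnapsackData.bitSum κ.v b (j + 1) →
        Halts (.setReg 24 (reg 24 / 2)) s'' 1 fun s'' => s''.reg 20 = j ∧
          (s''.setReg 20 (j + 1)).reg 24 = b / 2 ^ (j + 1) ∧
          (∀ g < j + 1, (s''.setReg 20 (j + 1)).arr 13 g = if b.testBit g = true then 1 else 0) ∧
          (s''.setReg 20 (j + 1)).reg 25 = KnapsackData.bitSum κ.v b (j + 1) := by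
      intro s'' a₁ a₂ a₃ a₄
      refine Halts.setReg ⟨by simpa using a₁, ?_, fun g hg => ?_, by simpa using a₄⟩
      · simp [a₂, pow_succ, Nat.div_div_eq_div_mul]
      · simp only [Memory.setReg_arr, a₃, Memory.setArr_arr, true_and]
        rcases eq_or_ne g j with rfl | hne
        · simp
        · simpa [hne] using h13 g (by omega)
    refine Halts.branch (k := 1) (fun hc => Halts.setReg (hfin _ ?_ ?_ rfl ?_))
      (fun hc => Halts.skip (hfin _ hj h24 rfl ?_))
    · simpa using hj
    · simpa using h24
    · have ht : b.testBit j = true := by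
        by_contra hcon
        simp [hj, hcon] at hc
      simp [hj, h25, h'.arrV j hlt, KnapsackData.bitSum, Finset.sum_range_succ, ht]
    · have ht : b.testBit j = false := by
        by_contra hcon
        simp [hj, hcon] at hc
      simp [h25, KnapsackData.bitSum, Finset.sum_range_succ, ht]

/-- A bound for the number of steps of the dynamic program. -/
def dpSteps (m X : ℕ) : ℕ := m * (X * 7 + 30) + X * 11 + 40

theorem dpProgram_halts (h : DPInput κ m N D s) :
    Halts dpProgram s (dpSteps m (KnapsackData.scaledBound m N D)) fun s' =>
      (∀ g < m, s'.arr 13 g = if (κ.mask m N D).testBit g = true then 1 else 0) ∧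
      s'.reg 25 = KnapsackData.bitSum κ.v (κ.mask m N D) m := by
  set X := KnapsackData.scaledBound m N D with hX
  have e : dpSteps m X = 1 + (m * 5 + 5) + (1 + (X * 6 + 11) + (1 + (m * (X * 7 + 16) + 5) +
      (1 + (X * 5 + 10) + (m * 9 + 5)))) := by rw [dpSteps]; ring
  rw [e]
  refine Halts.seq ((topProgram_halts h).mono le_rfl fun s₁ a₁ h₁ => ?_)
  replace h := h.agree a₁ (by decide)
  refine Halts.seq ((initProgram_halts h (κ.scaled m N D)).mono le_rfl fun s₂ a₂ h₂ => ?_)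
  replace h := h.agree a₂ (by decide)
  replace h₁ := (a₂.1 22 (by decide)).trans h₁
  refine Halts.seq ((tableProgram_halts h h₁ h₂).mono le_rfl fun s₃ a₃ h₃ => ?_)
  replace h := h.agree a₃ (by decide)
  refine Halts.seq ((bestProgram_halts h _ h₃).mono le_rfl fun s₄ a₄ h₄ => ?_)
  replace h := h.agree a₄ (by decide)
  exact decodeProgram_halts h h₄

end DynamicProgram

section Analysis

/-! ### Analysis of the algorithm with an arbitrary knapsack routine -/

namespace FairInstance

variable (I : FairInstance)

theorem value_nonneg (a : Fin I.n) (S : Finset (Fin I.m)) : 0 ≤ I.value a S :=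
  Finset.sum_nonneg fun _ _ => Nat.cast_nonneg _

theorem value_eq_cast (a : Fin I.n) (S : Finset (Fin I.m)) :
    I.value a S = (∑ g ∈ S, I.val a g : ℕ) := by
  simp [value]

theorem mem_charity {A : I.Bundles} {g : Fin I.m} : g ∈ I.charity A ↔ ∀ a, g ∉ A a := by
  simp [charity]

/-- A single value is less than two to its number of bits, and there are at most `I.m ≤ 2 ^ I.m`
summands; both exponents are part of the input size. -/
theorem value_le_two_pow (ε : ℚ) (a : Fin I.n) (S : Finset (Fin I.m)) :
    I.value a S ≤ 2 ^ I.inputSize ε := by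
  rw [value_eq_cast]
  have h₁ : ∀ g ∈ S, I.val a g ≤ 2 ^ ∑ a, ∑ g, ((I.val a g).size + (I.size a g).size) := by
    intro g _
    refine (Nat.lt_size_self _).le.trans (Nat.pow_le_pow_right (by norm_num) ?_)
    calc (I.val a g).size ≤ (I.val a g).size + (I.size a g).size := Nat.le_add_right _ _
      _ ≤ ∑ g, ((I.val a g).size + (I.size a g).size) :=
        Finset.single_le_sum (f := fun g => (I.val a g).size + (I.size a g).size)
          (fun _ _ => Nat.zero_le _) (Finset.mem_univ g)
      _ ≤ _ :=
        Finset.single_le_sum (f := fun a => ∑ g, ((I.val a g).size + (I.size a g).size))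
          (fun _ _ => Nat.zero_le _) (Finset.mem_univ a)
  have h₂ := Finset.sum_le_card_nsmul S _ _ h₁
  have h₃ : S.card ≤ 2 ^ I.m :=
    (by simpa using Finset.card_le_univ S : S.card ≤ I.m).trans Nat.lt_two_pow_self.le
  have h₄ : ∑ g ∈ S, I.val a g ≤ 2 ^ I.inputSize ε := by
    refine h₂.trans ?_
    rw [smul_eq_mul]
    refine (Nat.mul_le_mul_right _ h₃).trans ?_
    rw [← pow_add]
    exact Nat.pow_le_pow_right (by norm_num) (by rw [inputSize]; omega)
  exact_mod_cast h₄

end FairInstance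

variable {K : KnapsackRoutine} {I : FairInstance} {ε : ℚ} {A : I.Bundles}
  {T T' : Finset (Fin I.m)} {a k : Fin I.n} {t : ℕ}

theorem KnapsackRoutine.IsApproximate.apxKns_spec (hK : K.IsApproximate) (hε : 0 < ε)
    (hε' : ε < 1) (a : Fin I.n) (T : Finset (Fin I.m)) :
    apxKns K I a T (ε / 2) ⊆ T ∧ I.Feasible a (apxKns K I a T (ε / 2)) ∧
      ∀ S ⊆ T, I.Feasible a S →
        (1 - ε / 2) * I.value a S ≤ I.value a (apxKns K I a T (ε / 2)) :=
  hK I.m (I.val a) (I.size a) T (I.budget a) (ε / 2) (by linarith) (by linarith)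

/-- A set that fails the test has no envied subset. -/
theorem not_approxEnvies_of_not_test (hK : K.IsApproximate) (hε : 0 < ε) (hε' : ε < 1)
    (h : ¬ Test K I ε A a T) (hT : T' ⊆ T) : ¬ I.ApproxEnvies ε A a T' := by
  rintro ⟨S, hS, hf, hlt⟩
  rw [Test, not_lt] at h
  have h₁ := (hK.apxKns_spec hε hε' a T).2.2 S (hS.trans hT) hf
  have h₂ := I.value_nonneg a S
  have h₃ : (1 - ε / 2) * ((1 - ε / 2) * I.value a S)
      ≤ (1 - ε / 2) * I.value a (apxKns K I a T (ε / 2)) :=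
    mul_le_mul_of_nonneg_left h₁ (by linarith)
  -- This is `(1 - ε/2)² = 1 - ε + ε²/4`.
  nlinarith [mul_nonneg (sq_nonneg ε) h₂]

theorem shrinkStep_invariant {x y : Finset (Fin I.m) × Fin I.n}
    (h : Relation.ReflTransGen (ShrinkStep K I ε A) x y) (hx : Test K I ε A x.2 x.1) :
    y.1 ⊆ x.1 ∧ Test K I ε A y.2 y.1 := by
  induction h with
  | refl => exact ⟨subset_rfl, hx⟩
  | tail _ hs ih =>
    obtain ⟨g, hg, a, ha, rfl⟩ := hs
    exact ⟨(Finset.erase_subset _ _).trans ih.1, ha⟩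

/-- The current agent passes the test on the current set throughout, and at the end this test speaks
of the returned bundle itself. Minimality uses the stopping condition on the larger set `T₀`, from
which the bundle was selected. -/
theorem ApxMinEnvied.spec (hK : K.IsApproximate) (hε : 0 < ε) (hε' : ε < 1)
    (h : ApxMinEnvied K I ε A T k) :
    T ⊆ I.charity A ∧ I.IsApproxMinEnvied ε A T k ∧
      I.value k (A k) < (1 - ε / 2) * I.value k T := by
  obtain ⟨k₀, T₀, h₀, hr, hend, rfl⟩ := h
  obtain ⟨hsub, htest⟩ := shrinkStep_invariant hr h₀
  obtain ⟨h₁, h₂, h₃⟩ := hK.apxKns_spec (I := I) hε hε' k T₀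
  refine ⟨h₁.trans hsub, ⟨⟨⟨_, subset_rfl, h₂, htest⟩, h₂⟩, fun T' hT' k' => ?_⟩, htest⟩
  -- A strict subset of the selection misses some `g` of `T₀`, hence lies in `T₀.erase g`.
  obtain ⟨g, hg, hg'⟩ := Finset.exists_of_ssubset hT'
  refine not_approxEnvies_of_not_test hK hε hε' (hend g (h₁ hg) k') fun x hx => ?_
  exact Finset.mem_erase.2 ⟨fun hh => hg' (hh ▸ hx), h₁ (hT'.1 hx)⟩

theorem ApxMinEnvied.value_lt (hK : K.IsApproximate) (hε : 0 < ε) (hε' : ε < 1)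
    (h : ApxMinEnvied K I ε A T k) : 1 / (1 - ε / 2) * I.value k (A k) < I.value k T := by
  have h₁ := (h.spec hK hε hε').2.2
  have h₂ : 0 < 1 - ε / 2 := by linarith
  rw [one_div, inv_mul_lt_iff₀ h₂]
  exact h₁

/-- Every shrinking step removes a good, so greedy shrinking gets stuck; the induction is on the
cardinality. -/
theorem exists_apxMinEnvied (h : LoopCondition K I ε A) : ∃ T k, ApxMinEnvied K I ε A T k := by
  obtain ⟨k₀, h₀⟩ := h
  suffices H : ∀ (c : ℕ) (x : Finset (Fin I.m) × Fin I.n), x.1.card = c →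
      Relation.ReflTransGen (ShrinkStep K I ε A) (I.charity A, k₀) x →
      ∃ T k, ApxMinEnvied K I ε A T k from H _ _ rfl .refl
  intro c
  induction c with
  | zero =>
    intro x hx hr
    refine ⟨_, x.2, k₀, x.1, h₀, hr, fun g hg => ?_, rfl⟩
    rw [Finset.card_eq_zero] at hx
    simp [hx] at hg
  | succ c ih =>
    intro x hx hr
    by_cases hend : ∀ g' ∈ x.1, ∀ a', ¬ Test K I ε A a' (x.1.erase g')
    · exact ⟨_, x.2, k₀, x.1, h₀, hr, hend, rfl⟩
    · push Not at hend
      obtain ⟨g, hg, a', ha'⟩ := hend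
      exact ih (x.1.erase g, a') (by rw [Finset.card_erase_of_mem hg, hx]; rfl)
        (hr.tail ⟨g, hg, a', ha', rfl⟩)

theorem AfterIterations.isAllocation (hK : K.IsApproximate) (hε : 0 < ε) (hε' : ε < 1)
    (h : AfterIterations K I ε t A) : I.IsAllocation A := by
  induction h with
  | start =>
    refine ⟨fun _ _ _ => Finset.disjoint_empty_left _, fun a => ?_⟩
    rw [FairInstance.Feasible, Finset.sum_empty]
    exact_mod_cast (I.budget a).2
  | @update t A T k _ _ hT ih =>
    obtain ⟨h₁, ⟨⟨_, h₂⟩, _⟩, _⟩ := hT.spec hK hε hε'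
    have hd : ∀ b, Disjoint T (A b) := fun b =>
      Finset.disjoint_left.2 fun g hg => I.mem_charity.1 (h₁ hg) b
    refine ⟨fun a b hab => ?_, fun a => ?_⟩
    · rw [Function.update_apply, Function.update_apply]
      split_ifs with ha hb hb
      · exact absurd (ha.trans hb.symm) hab
      · exact hd b
      · exact (hd a).symm
      · exact ih.1 a b hab
    · rw [Function.update_apply]
      split_ifs with ha
      · exact ha ▸ h₂
      · exact ih.2 a

theorem ApxMinEnvied.value_le_update (hK : K.IsApproximate) (hε : 0 < ε) (hε' : ε < 1)
    (h : ApxMinEnvied K I ε A T k) (a : Fin I.n) :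
    I.value a (A a) ≤ I.value a (Function.update A k T a) := by
  rw [Function.update_apply]
  split_ifs with ha
  · subst ha
    have := (h.spec hK hε hε').2.2
    nlinarith [I.value_nonneg a T]
  · exact le_rfl

/-- The new bundle is safe by minimality. The condition is tested against the values before the
update, which is harmless because no agent loses value; for the same reason the older bundles stay
safe. -/
theorem AfterIterations.approxFEFx_bundles (hK : K.IsApproximate) (hε : 0 < ε) (hε' : ε < 1)
    (h : AfterIterations K I ε t A) (a b : Fin I.n) (S : Finset (Fin I.m)) (hS : S ⊂ A b)
    (hf : I.Feasible a S) : (1 - ε) * I.value a S ≤ I.value a (A a) := by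
  induction h with
  | start => exact absurd hS (Finset.not_ssubset_empty S)
  | @update t A T k _ _ hT ih =>
    refine le_trans ?_ (hT.value_le_update hK hε hε' a)
    rw [Function.update_apply] at hS
    split_ifs at hS with hb
    · have := (hT.spec hK hε hε').2.1.2 S hS a
      by_contra hcon
      exact this ⟨S, subset_rfl, hf, not_le.1 hcon⟩
    · exact ih hS

theorem Returns.isAllocation_and_isApproxFEFx (hK : K.IsApproximate) (hε : 0 < ε) (hε' : ε < 1)
    (h : Returns K I ε A) : I.IsAllocation A ∧ I.IsApproxFEFx ε A := by
  obtain ⟨⟨t, ht⟩, hend⟩ := h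
  refine ⟨ht.isAllocation hK hε hε', ht.approxFEFx_bundles hK hε hε', fun a S hS hf => ?_⟩
  by_contra hcon
  refine not_approxEnvies_of_not_test hK hε hε' (fun hh => hend ⟨a, hh⟩) subset_rfl
    ⟨S, hS.1, hf, not_le.1 hcon⟩

/-- After `c` updates, the value of an agent is at least `(1 + ε / 2) ^ (c - 1)`. -/
theorem AfterIterations.exists_updates (hK : K.IsApproximate) (hε : 0 < ε) (hε' : ε < 1)
    (h : AfterIterations K I ε t A) :
    ∃ c : Fin I.n → ℕ, ∑ a, c a = t ∧
      ∀ a, c a ≠ 0 → (1 + ε / 2) ^ (c a - 1) ≤ I.value a (A a) := by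
  induction h with
  | start => exact ⟨0, by simp, by simp⟩
  | @update t A T k _ _ hT ih =>
    obtain ⟨c, hc, hv⟩ := ih
    refine ⟨Function.update c k (c k + 1), ?_, fun a ha => ?_⟩
    · rw [Finset.sum_update_of_mem (Finset.mem_univ k), ← hc,
        ← Finset.add_sum_erase _ c (Finset.mem_univ k), Finset.sdiff_singleton_eq_erase]
      ring
    · rcases eq_or_ne a k with rfl | hak
      · have hlt := (hT.spec hK hε hε').2.2
        rw [Function.update_self, Function.update_self, Nat.add_sub_cancel]
        rcases Nat.eq_zero_or_pos (c a) with h0 | h0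
        · rw [h0, pow_zero]
          -- The first update yields a positive value, hence at least `1` by integrality.
          have hpos : 0 < I.value a T := by nlinarith [I.value_nonneg a (A a)]
          rw [I.value_eq_cast] at hpos ⊢
          exact_mod_cast hpos
        · obtain ⟨d, hd⟩ : ∃ d, c a = d + 1 := ⟨c a - 1, by omega⟩
          have hd' := hv a h0.ne'
          rw [hd] at hd' ⊢
          rw [Nat.add_sub_cancel] at hd'
          rw [pow_succ]
          -- Here `(1 + ε/2) * (1 - ε/2) ≤ 1` converts the gain of the update into a factor `1 +
          -- ε/2`.
          nlinarith [I.value_nonneg a T, mul_nonneg (sq_nonneg ε) (I.value_nonneg a T)]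
      · rw [Function.update_of_ne hak] at ha ⊢
        rw [Function.update_of_ne hak]
        exact hv a ha

/-- By Bernoulli's inequality, `⌈2/ε⌉` factors `1 + ε/2` already double. -/
theorem le_of_one_add_pow_le (hε : 0 < ε) {c B : ℕ} (h : (1 + ε / 2) ^ c ≤ 2 ^ B) :
    c ≤ ⌈2 / ε⌉₊ * B := by
  by_contra hcon
  have h₁ : (2 : ℚ) ≤ (1 + ε / 2) ^ ⌈2 / ε⌉₊ := by
    have h₂ := one_add_mul_le_pow (a := ε / 2) (by linarith) ⌈2 / ε⌉₊
    have h₃ : 2 / ε ≤ ⌈2 / ε⌉₊ := Nat.le_ceil _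
    rw [div_le_iff₀ hε] at h₃
    linarith
  have h₄ : (2 : ℚ) ^ B ≤ (1 + ε / 2) ^ (⌈2 / ε⌉₊ * B) := by
    rw [pow_mul]; gcongr
  have h₅ : (1 + ε / 2) ^ (⌈2 / ε⌉₊ * B) < (1 + ε / 2) ^ c :=
    pow_lt_pow_right₀ (by linarith) (not_le.1 hcon)
  linarith

theorem AfterIterations.le (hK : K.IsApproximate) (hε : 0 < ε) (hε' : ε < 1)
    (h : AfterIterations K I ε t A) : t ≤ I.n * (⌈2 / ε⌉₊ * I.inputSize ε + 1) := by
  obtain ⟨c, hc, hv⟩ := h.exists_updates hK hε hε'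
  rw [← hc]
  -- The extra `1` is the first update, which only lifts the value to at least `1`.
  have : ∀ a ∈ Finset.univ, c a ≤ ⌈2 / ε⌉₊ * I.inputSize ε + 1 := by
    intro a _
    rcases Nat.eq_zero_or_pos (c a) with h0 | h0
    · omega
    · have := le_of_one_add_pow_le hε ((hv a h0.ne').trans (I.value_le_two_pow ε a _))
      omega
  simpa using Finset.sum_le_card_nsmul _ _ _ this

/-! ### Polynomial bounds -/

/-- `f` is bounded by a polynomial in `Y`. -/
def PolyBounded {ι : Type*} (Y : ι → ℚ) (f : ι → ℕ) : Prop :=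
  ∃ c d : ℕ, ∀ i, (f i : ℚ) ≤ c * Y i ^ d

namespace PolyBounded

variable {ι : Type*} {Y : ι → ℚ} {f g : ι → ℕ}

theorem mono (hg : PolyBounded Y g) (h : ∀ i, f i ≤ g i) : PolyBounded Y f := by
  obtain ⟨c, d, hc⟩ := hg
  exact ⟨c, d, fun i => le_trans (by exact_mod_cast h i) (hc i)⟩

theorem const (n : ℕ) : PolyBounded Y fun _ => n := ⟨n, 0, by simp⟩

theorem of_le (h : ∀ i, (f i : ℚ) ≤ Y i) : PolyBounded Y f := ⟨1, 1, by simpa using h⟩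

theorem mul (hf : PolyBounded Y f) (hg : PolyBounded Y g) :
    PolyBounded Y fun i => f i * g i := by
  obtain ⟨c, d, hc⟩ := hf
  obtain ⟨c', d', hc'⟩ := hg
  refine ⟨c * c', d + d', fun i => ?_⟩
  push_cast
  calc (f i : ℚ) * g i ≤ (c * Y i ^ d) * (c' * Y i ^ d') :=
        mul_le_mul (hc i) (hc' i) (Nat.cast_nonneg _) ((Nat.cast_nonneg _).trans (hc i))
    _ = _ := by ring

theorem add (hY : ∀ i, 1 ≤ Y i) (hf : PolyBounded Y f) (hg : PolyBounded Y g) :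
    PolyBounded Y fun i => f i + g i := by
  obtain ⟨c, d, hc⟩ := hf
  obtain ⟨c', d', hc'⟩ := hg
  refine ⟨c + c', d + d', fun i => ?_⟩
  push_cast
  rw [add_mul]
  refine add_le_add ((hc i).trans ?_) ((hc' i).trans ?_)
  · exact mul_le_mul_of_nonneg_left (pow_le_pow_right₀ (hY i) (by omega)) (Nat.cast_nonneg _)
  · exact mul_le_mul_of_nonneg_left (pow_le_pow_right₀ (hY i) (by omega)) (Nat.cast_nonneg _)

theorem pow (hf : PolyBounded Y f) (n : ℕ) : PolyBounded Y fun i => f i ^ n := by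
  obtain ⟨c, d, hc⟩ := hf
  refine ⟨c ^ n, d * n, fun i => ?_⟩
  push_cast
  calc (f i : ℚ) ^ n ≤ (c * Y i ^ d) ^ n := pow_le_pow_left₀ (Nat.cast_nonneg _) (hc i) n
    _ = _ := by rw [mul_pow, pow_mul]

theorem ceil (hY : ∀ i, 1 ≤ Y i) {x : ι → ℚ} {c : ℕ} (h : ∀ i, x i ≤ c * Y i) :
    PolyBounded Y fun i => ⌈x i⌉₊ := by
  refine ⟨c + 1, 1, fun i => ?_⟩
  have h₁ : (⌈x i⌉₊ : ℚ) ≤ ⌈(c : ℚ) * Y i⌉₊ := by exact_mod_cast Nat.ceil_mono (h i)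
  have h₂ := (Nat.ceil_lt_add_one (mul_nonneg (Nat.cast_nonneg c)
    (zero_le_one.trans (hY i)))).le
  have := hY i
  push_cast
  linarith

end PolyBounded

/-- A tame program with polynomially many steps on inputs of polynomial size runs in polynomial
time. -/
theorem PolyBounded.exec {ι : Type*} {Y : ι → ℚ} (hY : ∀ i, 1 ≤ Y i) {p : Program}
    (hp : p.tame = true) {k M : ι → ℕ} (hk : PolyBounded Y k) (hM : PolyBounded Y M) :
    ∃ c d : ℕ, ∀ i (s s' : Memory) (k' : ℕ), k' ≤ k i → s.SizeLE (M i) → Run p s s' k' →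
      ∃ t : ℕ, Exec p s s' t ∧ (t : ℚ) ≤ c * Y i ^ d := by
  obtain ⟨c, d, hc⟩ := hk.mul ((const p.costCoeff).mul
    (((hM.add hY ((const p.growth).mul hk)).add hY (const 1)).pow 2))
  refine ⟨c, d, fun i s s' k' hk' hs hr => ?_⟩
  obtain ⟨t, ht, hle⟩ := hr.exec hp hs
  refine ⟨t, ht, le_trans ?_ (hc i)⟩
  have : t ≤ k i * (p.costCoeff * (M i + p.growth * k i + 1) ^ 2) := hle.trans (by gcongr)
  exact_mod_cast this

end Analysis

section KnapsackProgram

open FairDivision.Expr (reg arr)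

/-! ### Programs with a polynomial number of steps -/

/-- The length of the table is controlled by `D / N = 1 / δ` alone and not by the sizes of the
values; the step bounds become polynomial through this. -/
theorem scaledBound_le (m N D : ℕ) :
    KnapsackData.scaledBound m N D ≤ m * (m * ⌈(D : ℚ) / N⌉₊) := by
  refine Nat.mul_le_mul_left _ ?_
  rcases Nat.eq_zero_or_pos N with rfl | hN
  · simp
  have hN' : (0 : ℚ) < N := by exact_mod_cast hN
  refine Nat.div_le_of_le_mul ?_
  have h : (D : ℚ) ≤ ⌈(D : ℚ) / N⌉₊ * N := (div_le_iff₀ hN').1 (Nat.le_ceil _)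
  have h' : D ≤ ⌈(D : ℚ) / N⌉₊ * N := by exact_mod_cast h
  calc m * D ≤ m * (⌈(D : ℚ) / N⌉₊ * N) := Nat.mul_le_mul_left _ h'
    _ = _ := by ring

/-- The parameters on which the bounds for the running times depend: the numbers of agents and
goods, the accuracy, and the size of the input. -/
structure SizeData where
  n : ℕ
  m : ℕ
  ε : ℚ
  B : ℕ
  pos : 0 < ε
  le_one : ε ≤ 1
  n_le : n ≤ B
  m_le : m ≤ B

namespace SizeData

/-- Running times have to be polynomial in this quantity. -/
def Y (x : SizeData) : ℚ := 1 / x.ε + x.B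

theorem one_le_inv (x : SizeData) : 1 ≤ 1 / x.ε := (one_le_div₀ x.pos).2 x.le_one

theorem one_le_Y (x : SizeData) : 1 ≤ x.Y := by
  have := x.one_le_inv
  have : (0 : ℚ) ≤ x.B := Nat.cast_nonneg _
  rw [Y]; linarith

theorem polyBounded_B : PolyBounded Y B := PolyBounded.of_le fun x => by
  have := x.one_le_inv
  rw [Y]; linarith

theorem polyBounded_n : PolyBounded Y n := polyBounded_B.mono n_le

theorem polyBounded_m : PolyBounded Y m := polyBounded_B.mono m_le

theorem polyBounded_ceil (c : ℕ) : PolyBounded Y fun x => ⌈(c : ℚ) / x.ε⌉₊ :=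
  PolyBounded.ceil (c := c) one_le_Y fun x => by
    have : (0 : ℚ) ≤ c * x.B := by positivity
    rw [Y, mul_add, mul_one_div]
    linarith

/-- A bound for the number of steps of the dynamic program for `m` items and accuracy
`ε / c`. -/
def dpSteps (c : ℕ) (x : SizeData) : ℕ :=
  FairDivision.dpSteps x.m (x.m * (x.m * ⌈(c : ℚ) / x.ε⌉₊))

theorem polyBounded_dpSteps (c : ℕ) : PolyBounded Y (dpSteps c) := by
  have hX : PolyBounded Y fun x => x.m * (x.m * ⌈(c : ℚ) / x.ε⌉₊) :=
    polyBounded_m.mul (polyBounded_m.mul (polyBounded_ceil c))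
  have h := fun n => PolyBounded.const (Y := Y) n
  exact (((polyBounded_m.mul ((hX.mul (h 7)).add one_le_Y (h 30))).add one_le_Y
    (hX.mul (h 11))).add one_le_Y (h 40))

end SizeData

theorem dpSteps_mono {m X X' : ℕ} (h : X ≤ X') : dpSteps m X ≤ dpSteps m X' := by
  unfold dpSteps; gcongr

/-- `for g := 0, …, m - 1 do if b then array β [g] := e`. -/
def fillProgram (β : ℕ) (b e : Expr) : Program :=
  .forLoop 20 (reg 10) (.branch b (.setArr β (reg 20) e) .skip)

/-- The condition and the expression may read the very cell that is about to be written, since cell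
`j` is untouched until round `j`. -/
theorem fillProgram_halts {β m : ℕ} {b e : Expr} {s : Memory} (hm : s.reg 10 = m)
    (c : ℕ → Prop) [DecidablePred c] (f : ℕ → ℕ)
    (h : ∀ j < m, ∀ s', Agree (fillProgram β b e) s s' → s'.reg 20 = j →
      s'.arr β j = s.arr β j → (b.eval s' ≠ 0 ↔ c j) ∧ e.eval s' = f j) :
    Halts (fillProgram β b e) s (m * 5 + 3) fun s' =>
      ∀ j < m, s'.arr β j = if c j then f j else s.arr β j := by
  refine Halts.forLoop (k := 2) (fun i s' =>
    (∀ j < i, s'.arr β j = if c j then f j else s.arr β j) ∧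
      ∀ j, i ≤ j → s'.arr β j = s.arr β j) (by simp) ?_ ?_ (fun s' _ h => h.1)
  · intro j s' ha _
    simpa using (ha.1 10 (by simp [Program.forLoop, Program.regs])).trans hm
  · intro i s' ha hI hi hlt
    obtain ⟨h₁, h₂⟩ := h i hlt s' ha hi (hI.2 i le_rfl)
    refine Halts.branch (k := 1) (fun hb => Halts.setArr ?_) (fun hb => Halts.skip ?_)
    · have hc := h₁.1 hb
      refine ⟨hi, fun j hj => ?_, fun j hj => ?_⟩
      · rw [Memory.setReg_arr, Memory.setArr_arr, Expr.eval_reg, hi, h₂]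
        rcases eq_or_ne j i with rfl | hne
        · simp [hc]
        · simpa [hne] using hI.1 j (by omega)
      · rw [Memory.setReg_arr, Memory.setArr_arr, Expr.eval_reg, hi, if_neg (by omega)]
        exact hI.2 j (by omega)
    · have hc : ¬ c i := fun hh => h₁.2 hh hb
      refine ⟨hi, fun j hj => ?_, fun j hj => hI.2 j (by omega)⟩
      rw [Memory.setReg_arr]
      rcases eq_or_ne j i with rfl | hne
      · rw [if_neg hc]; exact hI.2 j le_rfl
      · exact hI.1 j (by omega)

/-! ### The knapsack routine as a program -/

local infixr:60 " ;; " => Program.seq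

def copyProgram : Program :=
  .setReg 10 (reg 0) ;; .setReg 11 (reg 1) ;; .setReg 12 (reg 2) ;; .setReg 13 (reg 3) ;;
  .setReg 14 (reg 4) ;; fillProgram 10 1 (arr 0 (reg 20)) ;; fillProgram 11 1 (arr 1 (reg 20)) ;;
  fillProgram 12 1 (arr 2 (reg 20))

def knapsackProgram : Program :=
  copyProgram ;; dpProgram ;; fillProgram 3 1 (arr 13 (reg 20))

section Knapsack

variable {m : ℕ} (v w : Fin m → ℕ) (T : Finset (Fin m)) (W : ℚ≥0) (δ : ℚ)

theorem copyProgram_halts :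
    Halts copyProgram (knapsackInput m v w T W δ) (m * 15 + 21)
      (DPInput (knapsackData v w T W) m δ.num.natAbs δ.den) := by
  refine (Halts.seq (k := 1) (k' := 1 + 1 + (1 + 1 + (1 + 1 + (1 + 1 + (1 + (m * 5 + 3) +
    (1 + (m * 5 + 3) + (m * 5 + 3))))))) ?_).mono (by omega) (fun _ _ h => h)
  refine Halts.setReg (Halts.seq (Halts.setReg (Halts.seq (Halts.setReg (Halts.seq (Halts.setReg
    (Halts.seq (Halts.setReg (Halts.seq ?_)))))))))
  refine (fillProgram_halts (m := m) ?_ (fun _ => True) (ofVector v) ?_).mono le_rfl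
    fun s₁ a₁ h₁ => ?_
  · simp [knapsackInput]
  · intro j _ s' ha h20 _
    simp [h20, ha.2 0 (by decide), knapsackInput]
  refine Halts.seq ((fillProgram_halts (m := m) ?_ (fun _ => True) (ofVector w) ?_).mono le_rfl
    fun s₂ a₂ h₂ => ?_)
  · simp [a₁.1 10 (by decide), knapsackInput]
  · intro j _ s' ha h20 _
    simp [h20, ha.2 1 (by decide), a₁.2 1 (by decide), knapsackInput]
  refine (fillProgram_halts (m := m) ?_ (fun _ => True)
    (ofVector fun g => if g ∈ T then 1 else 0) ?_).mono le_rfl fun s₃ a₃ h₃ => ?_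
  · simp [a₂.1 10 (by decide), a₁.1 10 (by decide), knapsackInput]
  · intro j _ s' ha h20 _
    simp [h20, ha.2 2 (by decide), a₂.2 2 (by decide), a₁.2 2 (by decide), knapsackInput]
  have hr : ∀ r, r ≠ 20 → s₃.reg r = s₁.reg r := fun r hr =>
    (a₃.1 r (by simpa [fillProgram, Program.forLoop, Program.regs] using hr)).trans
      (a₂.1 r (by simpa [fillProgram, Program.forLoop, Program.regs] using hr))
  constructor
  · simp [hr, a₁.1 10 (by decide), knapsackInput]
  · simp [hr, a₁.1 11 (by decide), knapsackInput, knapsackData]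
  · simp [hr, a₁.1 12 (by decide), knapsackInput, knapsackData]
  · simp [hr, a₁.1 13 (by decide), knapsackInput]
  · simp [hr, a₁.1 14 (by decide), knapsackInput]
  · intro g hg
    rw [a₃.2 10 (by decide), a₂.2 10 (by decide), h₁ g hg, if_pos trivial]; rfl
  · intro g hg
    rw [a₃.2 11 (by decide), h₂ g hg, if_pos trivial]; rfl
  · intro g hg
    rw [h₃ g hg, if_pos trivial]; rfl

theorem knapsackProgram_halts :
    Halts knapsackProgram (knapsackInput m v w T W δ)
      (dpSteps m (KnapsackData.scaledBound m δ.num.natAbs δ.den) + (m * 20 + 26))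
      (KnapsackOutput (dpKnapsack m v w T W δ)) := by
  set X := KnapsackData.scaledBound m δ.num.natAbs δ.den with hX
  refine (Halts.seq (k := m * 15 + 21) (k' := 1 + dpSteps m X + (m * 5 + 3)) ?_).mono (by omega)
    (fun _ _ h => h)
  refine (copyProgram_halts v w T W δ).mono le_rfl fun s₁ _ h₁ => Halts.seq ?_
  refine (dpProgram_halts h₁).mono le_rfl fun s₂ a₂ h₂ => ?_
  refine (fillProgram_halts (h₁.agree a₂ (by decide)).regM (fun _ => True) (fun j =>
    if ((knapsackData v w T W).mask m δ.num.natAbs δ.den).testBit j = true then 1 else 0) ?_).mono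
    le_rfl fun s₃ _ h₃ => ?_
  · intro j hj s' ha h20 _
    simp [h20, ha.2 13 (by decide), h₂.1 j hj]
  · intro g
    rw [h₃ g g.2, if_pos trivial]
    simp [dpKnapsack]

theorem size_ofVector_le (f : Fin m → ℕ) (i : ℕ) : (ofVector f i).size ≤ ∑ g, (f g).size := by
  unfold ofVector
  split_ifs with h
  · exact Finset.single_le_sum (f := fun g => (f g).size) (fun _ _ => Nat.zero_le _)
      (Finset.mem_univ _)
  · simp

theorem size_le_self (n : ℕ) : n.size ≤ n := Nat.size_le.2 Nat.lt_two_pow_self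

theorem knapsackInput_sizeLE :
    (knapsackInput m v w T W δ).SizeLE (knapsackInputSize m v w W δ) := by
  have hs : knapsackInputSize m v w W δ = m + (∑ g, (v g).size + ∑ g, (w g).size) + W.num.size
      + W.den.size + δ.num.natAbs.size + δ.den.size := by
    rw [knapsackInputSize, Finset.sum_add_distrib]
  rw [hs]
  constructor
  · intro r
    have := size_le_self m
    rcases r with _ | _ | _ | _ | _ | r <;> simp only [knapsackInput]
    all_goals first | omega | simp
  · intro α i
    rcases α with _ | _ | _ | α <;> simp only [knapsackInput]
    · have := size_ofVector_le v i; omega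
    · have := size_ofVector_le w i; omega
    · have h := size_ofVector_le (fun g => if g ∈ T then 1 else 0) i
      have h' : ∑ g : Fin m, (if g ∈ T then 1 else 0 : ℕ).size ≤ m := by
        calc _ ≤ ∑ g : Fin m, 1 := Finset.sum_le_sum fun g _ => by split_ifs <;> simp
          _ = m := by simp
      omega
    · simp

end Knapsack

theorem dpKnapsack_isFPTAS : dpKnapsack.IsFPTAS := by
  have hk : PolyBounded SizeData.Y fun x => x.dpSteps 1 + (x.m * 20 + 26) :=
    (SizeData.polyBounded_dpSteps 1).add SizeData.one_le_Y
      ((SizeData.polyBounded_m.mul (.const 20)).add SizeData.one_le_Y (.const 26))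
  obtain ⟨c, d, h⟩ := PolyBounded.exec SizeData.one_le_Y (p := knapsackProgram) (by decide) hk
    SizeData.polyBounded_B
  refine ⟨dpKnapsack_isApproximate, knapsackProgram, c, d, fun m v w T W δ hδ hδ' => ?_⟩
  obtain ⟨s, k, hk, hr, hs⟩ := knapsackProgram_halts v w T W δ
  have hle : dpSteps m (KnapsackData.scaledBound m δ.num.natAbs δ.den) ≤
      dpSteps m (m * (m * ⌈((1 : ℕ) : ℚ) / δ⌉₊)) := by
    refine dpSteps_mono ((scaledBound_le _ _ _).trans (le_of_eq ?_))
    conv_rhs => rw [← natAbs_num_div_den hδ, Nat.cast_one, one_div_div]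
  -- A knapsack input involves no agents, hence `n := 0`.
  obtain ⟨t, ht, hle⟩ := h
    { n := 0, m := m, ε := δ, B := knapsackInputSize m v w W δ, pos := hδ, le_one := hδ',
      n_le := Nat.zero_le _, m_le := by rw [knapsackInputSize]; omega } _ s k
    (hk.trans (Nat.add_le_add_right hle _)) (knapsackInput_sizeLE v w T W δ) hr
  exact ⟨s, t, ht, hs, hle⟩

end KnapsackProgram

section FairProgram

open FairDivision.Expr (reg arr)

local infixr:60 " ;; " => Program.seq

/-! ### The algorithm as a program

Registers `10, 13, 14` hold the number of goods and the numerator and denominator of `ε / 2`. Array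
`4` holds the allocation, array `5` the values of the bundles for their agents, and array `12` the set
of goods under consideration. -/

/-- The memory contains the input. -/
structure FairBase (I : FairInstance) (ε : ℚ) (s : Memory) : Prop where
  agents : s.reg 0 = I.n
  goods : s.reg 1 = I.m
  goods' : s.reg 10 = I.m
  num : s.reg 13 = ε.num.natAbs
  den : s.reg 14 = ε.den + ε.den
  val : s.arr 0 = ofMatrix I.val
  size : s.arr 1 = ofMatrix I.size
  budgetNum : s.arr 2 = ofVector fun a => (I.budget a).num
  budgetDen : s.arr 3 = ofVector fun a => (I.budget a).den

variable {I : FairInstance} {ε : ℚ} {s s' : Memory} {A : I.Bundles}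
  {T : Finset (Fin I.m)} {a k : Fin I.n}

theorem FairBase.agree {p : Program} (h : FairBase I ε s) (ha : Agree p s s')
    (hp : (0 ∉ p.regs ∧ 1 ∉ p.regs ∧ 10 ∉ p.regs ∧ 13 ∉ p.regs ∧ 14 ∉ p.regs) ∧
      0 ∉ p.arrs ∧ 1 ∉ p.arrs ∧ 2 ∉ p.arrs ∧ 3 ∉ p.arrs) : FairBase I ε s' := by
  obtain ⟨⟨a, b, c, d, e⟩, x, y, z, w⟩ := hp
  exact ⟨(ha.1 _ a).trans h.agents, (ha.1 _ b).trans h.goods, (ha.1 _ c).trans h.goods',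
    (ha.1 _ d).trans h.num, (ha.1 _ e).trans h.den, (ha.2 _ x).trans h.val,
    (ha.2 _ y).trans h.size, (ha.2 _ z).trans h.budgetNum, (ha.2 _ w).trans h.budgetDen⟩

/-- Array `α` holds the indicator vector of `T`. -/
def IsIndicator {m : ℕ} (T : Finset (Fin m)) (f : ℕ → ℕ) : Prop :=
  ∀ g : Fin m, f g = if g ∈ T then 1 else 0

/-- The knapsack routine for the agent in register `30`. -/
def apxProgram : Program :=
  fillProgram 10 1 (arr 0 (reg 30 * reg 1 + reg 20)) ;;
  fillProgram 11 1 (arr 1 (reg 30 * reg 1 + reg 20)) ;;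
  .setReg 11 (arr 2 (reg 30)) ;; .setReg 12 (arr 3 (reg 30)) ;; dpProgram

/-- A bound for the number of steps of the dynamic program on the input. -/
def fairDPSteps (I : FairInstance) (ε : ℚ) : ℕ :=
  dpSteps I.m (KnapsackData.scaledBound I.m ε.num.natAbs (ε.den + ε.den))

theorem ofMatrix_apply {n m : ℕ} (f : Fin n → Fin m → ℕ) (a : Fin n) {g : ℕ} (hg : g < m) :
    ofMatrix f (a * m + g) = f a ⟨g, hg⟩ := by
  have hm : 0 < m := by omega
  have h₁ : ((a : ℕ) * m + g) / m = a := by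
    rw [mul_comm, Nat.mul_add_div hm, Nat.div_eq_of_lt hg, add_zero]
  have h₂ : ((a : ℕ) * m + g) % m = g := by
    rw [mul_comm, Nat.mul_add_mod, Nat.mod_eq_of_lt hg]
  simp [ofMatrix, h₁, h₂, hg]

/-- The program represents `ε / 2` by a doubled denominator without reducing the fraction; the
solution is still the one for the reduced fraction that the routine receives. -/
theorem half_mask {κ : KnapsackData} {m : ℕ} (hε : 0 < ε) :
    κ.mask m (ε / 2).num.natAbs (ε / 2).den = κ.mask m ε.num.natAbs (ε.den + ε.den) := by
  have hε₂ : 0 < ε / 2 := by linarith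
  refine KnapsackData.mask_congr (natAbs_num_pos hε₂) (natAbs_num_pos hε) ?_
  have h₁ := natAbs_num_div_den hε
  have h₂ := natAbs_num_div_den hε₂
  have hd₁ : (ε.den : ℚ) ≠ 0 := by exact_mod_cast ε.den_ne_zero
  have hd₂ : ((ε / 2).den : ℚ) ≠ 0 := by exact_mod_cast (ε / 2).den_ne_zero
  rw [div_eq_iff hd₁] at h₁
  rw [div_eq_iff hd₂] at h₂
  have : ((ε / 2).num.natAbs : ℚ) * (ε.den + ε.den) = ε.num.natAbs * (ε / 2).den := by
    rw [h₁, h₂]; ring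
  exact_mod_cast this

theorem apxProgram_halts (hε : 0 < ε) (h : FairBase I ε s) (hT : IsIndicator T (s.arr 12))
    (ha : s.reg 30 = a) :
    Halts apxProgram s (fairDPSteps I ε + (I.m * 10 + 12)) fun s' =>
      IsIndicator (apxKns dpKnapsack I a T (ε / 2)) (s'.arr 13) ∧
      s'.reg 25 = ∑ g ∈ apxKns dpKnapsack I a T (ε / 2), I.val a g := by
  refine (Halts.seq (k := I.m * 5 + 3) (k' := 1 + (I.m * 5 + 3) + (1 + 1 + (1 + 1 +
    fairDPSteps I ε))) ?_).mono (by omega) (fun _ _ h => h)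
  refine (fillProgram_halts h.goods' (fun _ => True) (ofVector (I.val a)) ?_).mono le_rfl
    fun s₁ a₁ h₁ => ?_
  · intro j hj s' ha' h20 _
    simp [h20, ha'.2 0 (by decide), ha'.1 1 (by decide), ha'.1 30 (by decide), h.val, h.goods, ha,
      ofMatrix_apply _ _ hj, ofVector_lt _ hj]
  have b₁ := h.agree a₁ (by decide)
  refine Halts.seq ((fillProgram_halts b₁.goods' (fun _ => True) (ofVector (I.size a)) ?_).mono
    le_rfl fun s₂ a₂ h₂ => ?_)
  · intro j hj s' ha' h20 _
    simp [h20, ha'.2 1 (by decide), ha'.1 1 (by decide), ha'.1 30 (by decide),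
      a₁.1 30 (by decide), b₁.size, b₁.goods, ha, ofMatrix_apply _ _ hj, ofVector_lt _ hj]
  have b₂ := b₁.agree a₂ (by decide)
  have h30 : s₂.reg 30 = a := by rw [a₂.1 30 (by decide), a₁.1 30 (by decide), ha]
  refine Halts.seq (Halts.setReg (Halts.seq (Halts.setReg ?_)))
  have hD : DPInput (knapsackData (I.val a) (I.size a) T (I.budget a)) I.m ε.num.natAbs
      (ε.den + ε.den) ((s₂.setReg 11 ((arr 2 (reg 30)).eval s₂)).setReg 12
        ((arr 3 (reg 30)).eval (s₂.setReg 11 ((arr 2 (reg 30)).eval s₂)))) := by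
    constructor
    · simp [b₂.goods']
    · simp [b₂.budgetNum, h30, ofVector_fin, knapsackData]
    · simp [b₂.budgetDen, h30, ofVector_fin, knapsackData]
    · simp [b₂.num]
    · simp [b₂.den]
    · intro g hg
      simp only [Memory.setReg_arr]
      rw [a₂.2 10 (by decide), h₁ g hg, if_pos trivial]; rfl
    · intro g hg
      simp only [Memory.setReg_arr]
      rw [h₂ g hg, if_pos trivial]; rfl
    · intro g hg
      simp only [Memory.setReg_arr]
      rw [a₂.2 12 (by decide), a₁.2 12 (by decide)]
      refine (hT ⟨g, hg⟩).trans ?_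
      simp [knapsackData, ofVector_lt _ hg]
  refine (dpProgram_halts hD).mono le_rfl fun s₃ _ h₃ => ?_
  rw [← half_mask hε] at h₃
  refine ⟨fun g => ?_, ?_⟩
  · rw [h₃.1 g g.2]
    simp [apxKns, dpKnapsack]
  · rw [h₃.2, apxKns, dpKnapsack, sum_filter_testBit]
    rfl

/-- The result of the search for an agent that passes the test on `T`. -/
def SearchResult (ε : ℚ) (A : I.Bundles) (T : Finset (Fin I.m)) (r : ℕ) : Prop :=
  (r = 0 ∧ ∀ a, ¬ Test dpKnapsack I ε A a T) ∨
    ∃ a : Fin I.n, r = a + 1 ∧ Test dpKnapsack I ε A a T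

/-- Array `5` holds the values of the bundles. -/
def HoldsValues (A : I.Bundles) (s : Memory) : Prop :=
  ∀ a : Fin I.n, s.arr 5 a = ∑ g ∈ A a, I.val a g

/-- All agents are tried, and the last one that passes is kept. The shift by one in register `31`
makes it nonzero exactly on success, so that it can serve directly as a condition. -/
def searchProgram : Program :=
  .setReg 31 0 ;;
  .forLoop 30 (reg 0)
    (apxProgram ;;
      .branch (.less (arr 5 (reg 30) * reg 14) ((reg 14 - reg 13) * reg 25))
        (.setReg 31 (reg 30 + 1)) .skip)

def searchSteps (I : FairInstance) (ε : ℚ) : ℕ :=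
  I.n * (fairDPSteps I ε + (I.m * 10 + 18)) + 5

/-- Both sides are multiplied by `2 * ε.den`; the truncated subtraction is exact because `ε.num ≤ 2
* ε.den`. -/
theorem test_iff (hε : 0 < ε) (hε' : ε < 1) {x y : ℕ} :
    (x : ℚ) < (1 - ε / 2) * y ↔
      x * (ε.den + ε.den) < (ε.den + ε.den - ε.num.natAbs) * y := by
  have h₁ := natAbs_num_div_den hε
  have hd : (0 : ℚ) < ε.den := by exact_mod_cast ε.den_pos
  have h₂ : ε.num.natAbs ≤ ε.den + ε.den := by
    have : (ε.num.natAbs : ℚ) ≤ ε.den + ε.den := by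
      rw [div_eq_iff hd.ne'] at h₁
      rw [h₁]; nlinarith
    exact_mod_cast this
  have h₃ : ((ε.den + ε.den - ε.num.natAbs : ℕ) : ℚ) = (1 - ε / 2) * (ε.den + ε.den) := by
    rw [Nat.cast_sub h₂]
    push_cast
    rw [div_eq_iff hd.ne'] at h₁
    rw [h₁]; ring
  have h₄ : (0 : ℚ) < ε.den + ε.den := by linarith
  rw [← mul_lt_mul_iff_left₀ h₄, ← Nat.cast_lt (α := ℚ), Nat.cast_mul, Nat.cast_mul, h₃,
    Nat.cast_add, mul_right_comm]

theorem searchProgram_halts (hε : 0 < ε) (hε' : ε < 1) (h : FairBase I ε s)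
    (hA : HoldsValues A s) (hT : IsIndicator T (s.arr 12)) :
    Halts searchProgram s (searchSteps I ε) fun s' => SearchResult ε A T (s'.reg 31) := by
  refine (Halts.seq (k := 1) (k' := I.n * (fairDPSteps I ε + (I.m * 10 + 15) + 3) + 3)
    (Halts.setReg ?_)).mono (by rw [searchSteps, add_assoc (fairDPSteps I ε), add_assoc (I.m * 10)]
                                omega) (fun _ _ h => h)
  refine Halts.forLoop (k := fairDPSteps I ε + (I.m * 10 + 15)) (fun j s' =>
    (s'.reg 31 = 0 ∧ ∀ a : Fin I.n, a < j → ¬ Test dpKnapsack I ε A a T) ∨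
      ∃ a : Fin I.n, s'.reg 31 = a + 1 ∧ Test dpKnapsack I ε A a T) (by simp) ?_ ?_ ?_
  · intro j s' ha _
    simpa using (ha.1 0 (by decide)).trans h.agents
  · intro j s₁ a₁ hI hj hlt
    have b₁ : FairBase I ε s₁ := (h.agree Run.setReg.agree (by decide)).agree a₁ (by decide)
    have t₁ : IsIndicator T (s₁.arr 12) := by rw [a₁.2 12 (by decide)]; exact hT
    refine (Halts.seq (k := fairDPSteps I ε + (I.m * 10 + 12)) (k' := 2) ?_).mono (by omega)
      (fun _ _ h => h)
    refine (apxProgram_halts (a := ⟨j, hlt⟩) hε b₁ t₁ hj).mono le_rfl fun s₂ a₂ h₂ => ?_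
    have b₂ := b₁.agree a₂ (by decide)
    have v₂ : s₂.arr 5 j = ∑ g ∈ A ⟨j, hlt⟩, I.val ⟨j, hlt⟩ g := by
      rw [a₂.2 5 (by decide), a₁.2 5 (by decide)]; exact hA ⟨j, hlt⟩
    have h30 : s₂.reg 30 = j := (a₂.1 30 (by decide)).trans hj
    have h31 : s₂.reg 31 = s₁.reg 31 := a₂.1 31 (by decide)
    have htest : Expr.eval s₂ (.less (arr 5 (reg 30) * reg 14) ((reg 14 - reg 13) * reg 25)) ≠ 0
        ↔ Test dpKnapsack I ε A ⟨j, hlt⟩ T := by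
      rw [Test, I.value_eq_cast, I.value_eq_cast, test_iff hε hε']
      simp [h30, v₂, b₂.den, b₂.num, h₂.2]
    refine Halts.branch (k := 1) (fun hb => Halts.setReg ?_) (fun hb => Halts.skip ?_)
    · rw [htest] at hb
      exact ⟨by simpa using h30, .inr ⟨⟨j, hlt⟩, by simp [h30], hb⟩⟩
    · replace hb := mt htest.2 (not_not.2 hb)
      refine ⟨h30, ?_⟩
      simp only [Memory.setReg_reg, show ¬ 31 = 30 from by decide, if_false, h31]
      refine hI.imp_left fun hh => ⟨hh.1, fun a haj => ?_⟩
      rcases Nat.lt_succ_iff_lt_or_eq.1 haj with hlt' | heq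
      · exact hh.2 a hlt'
      · obtain rfl : a = ⟨j, hlt⟩ := Fin.ext heq
        exact hb
  · intro s' _ hI
    exact hI.imp_left fun hh => ⟨hh.1, fun a => hh.2 a a.2⟩

/-- The while-loop of `ApxMinEnvied`. -/
def shrinkLoop : Program :=
  .loop (.less (reg 32) (reg 10))
    (.branch (arr 12 (reg 32))
      (.setArr 12 (reg 32) 0 ;; searchProgram ;;
        .branch (reg 31)
          (.setReg 33 (reg 31) ;; .setReg 32 0)
          (.setArr 12 (reg 32) 1 ;; .setReg 32 (reg 32 + 1)))
      (.setReg 32 (reg 32 + 1)))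

def shrinkProgram : Program := .setReg 33 (reg 31) ;; .setReg 32 0 ;; shrinkLoop

theorem IsIndicator.setArr_erase (hT : IsIndicator T (s.arr 12)) (g : Fin I.m) :
    IsIndicator (T.erase g) ((s.setArr 12 g 0).arr 12) := by
  intro x
  rw [Memory.setArr_arr, hT x]
  rcases eq_or_ne x g with rfl | hne
  · simp
  · simp [hne, Fin.val_ne_of_ne hne]

/-- `ApxMinEnvied` has reached the set in array `12` and the agent in register `33`. -/
def Reached (ε : ℚ) (A : I.Bundles) (k₀ : Fin I.n) (T : Finset (Fin I.m)) (k : Fin I.n)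
    (s : Memory) : Prop :=
  IsIndicator T (s.arr 12) ∧ s.reg 33 = k + 1 ∧
    Relation.ReflTransGen (ShrinkStep dpKnapsack I ε A) (I.charity A, k₀) (T, k)

/-- The potential is `T.card * (m + 1) + (m - p)` for the scanning position `p` in register `32`. A
removal restarts the scan, which costs at most `m` but saves `m + 1`. The restart is needed because
the invariant that no good below `p` can be removed refers to the current `T`. -/
theorem shrinkLoop_halts (hε : 0 < ε) (hε' : ε < 1) (h : FairBase I ε s) (hA : HoldsValues A s)
    {k₀ : Fin I.n} (hT : IsIndicator (I.charity A) (s.arr 12)) (hk : s.reg 33 = k₀ + 1)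
    (h32 : s.reg 32 = 0) :
    Halts shrinkLoop s ((I.m * (I.m + 1) + I.m) * (searchSteps I ε + 9) + 1) fun s' =>
      ∃ T k, Reached ε A k₀ T k s' ∧
        ∀ g ∈ T, ∀ a, ¬ Test dpKnapsack I ε A a (T.erase g) := by
  have hcard : (I.charity A).card ≤ I.m := by simpa using Finset.card_le_univ (I.charity A)
  refine (Halts.loop (k := searchSteps I ε + 8) (fun j s' => s'.reg 32 ≤ I.m ∧
    ∃ T k, Reached ε A k₀ T k s' ∧ j = T.card * (I.m + 1) + (I.m - s'.reg 32) ∧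
      ∀ g ∈ T, g < s'.reg 32 → ∀ a, ¬ Test dpKnapsack I ε A a (T.erase g)) ?_ ?_
    ((I.charity A).card * (I.m + 1) + I.m) ?_).mono (by gcongr) (fun _ _ h => h)
  · intro j s₁ a₁ ⟨hle, T, k, ⟨t₁, k₁, r₁⟩, hj, hg⟩ hb
    have b₁ : FairBase I ε s₁ := h.agree a₁ (by decide)
    have v₁ : HoldsValues A s₁ := fun a => by rw [a₁.2 5 (by decide)]; exact hA a
    have hlt : s₁.reg 32 < I.m := by
      by_contra hcon
      simp [b₁.goods', hcon] at hb
    set g : Fin I.m := ⟨s₁.reg 32, hlt⟩ with hgdef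
    have hgv : s₁.reg 32 = g := rfl
    refine ⟨by omega, (Halts.branch (k := searchSteps I ε + 7) (fun hb => ?_)
      (fun hb => ?_)).mono (by omega) (fun _ _ h => h)⟩
    · have hgT : g ∈ T := by
        by_contra hcon
        have := t₁ g
        rw [if_neg hcon] at this
        exact hb this
      have hcT := Finset.card_erase_add_one hgT
      have hcT' : T.card * (I.m + 1) = (T.erase g).card * (I.m + 1) + (I.m + 1) := by
        rw [← hcT]; ring
      refine (Halts.seq (k := 1) (k' := 1 + searchSteps I ε + 4) (Halts.setArr ?_)).mono (by omega)
        (fun _ _ h => h)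
      simp only [Expr.eval_reg, Expr.eval_zero, hgv]
      have t₂ := t₁.setArr_erase g
      set s₂ := s₁.setArr 12 g 0 with hs₂
      have b₂ : FairBase I ε s₂ := ⟨b₁.agents, b₁.goods, b₁.goods', b₁.num, b₁.den, b₁.val,
        b₁.size, b₁.budgetNum, b₁.budgetDen⟩
      have v₂ : HoldsValues A s₂ := v₁
      refine Halts.seq ((searchProgram_halts hε hε' b₂ v₂ t₂).mono le_rfl fun s₃ a₃ h₃ => ?_)
      have h32 : s₃.reg 32 = g := a₃.1 32 (by decide)
      have h33 : s₃.reg 33 = k + 1 := (a₃.1 33 (by decide)).trans k₁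
      have t₃ : IsIndicator (T.erase g) (s₃.arr 12) := by rw [a₃.2 12 (by decide)]; exact t₂
      refine Halts.branch (k := 3) (fun hb' => ?_) (fun hb' => ?_)
      · rcases h₃ with ⟨h0, _⟩ | ⟨a', ha', htest⟩
        · exact absurd h0 hb'
        · refine Halts.seq (k := 1) (k' := 1) (Halts.setReg (Halts.setReg ?_))
          refine ⟨(T.erase g).card * (I.m + 1) + I.m, by omega, by simp, T.erase g, a',
            ⟨t₃, by simp [ha'], r₁.tail ⟨g, hgT, a', htest, rfl⟩⟩, by simp, fun x _ hx => ?_⟩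
          simp at hx
      · rcases h₃ with ⟨_, hno⟩ | ⟨a', ha', _⟩
        · refine Halts.seq (k := 1) (k' := 1) (Halts.setArr (Halts.setReg ?_))
          refine ⟨T.card * (I.m + 1) + (I.m - (g + 1)), by omega, by simp [h32], T, k,
            ⟨fun x => ?_, by simpa using h33, r₁⟩, by simp [h32], fun x hx hlt' a => ?_⟩
          · simp only [Memory.setReg_arr, Memory.setArr_arr, Expr.eval_reg, Expr.eval_one, h32]
            rcases eq_or_ne x g with rfl | hne
            · simp [hgT]
            · rw [if_neg (fun hh => hne (Fin.ext hh.2)), t₃ x]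
              simp [hne]
          · simp only [Memory.setReg_reg, if_true, Expr.eval_add, Expr.eval_reg, Expr.eval_one,
              Memory.setArr_reg, h32] at hlt'
            rcases Nat.lt_succ_iff_lt_or_eq.1 hlt' with h | h
            · exact hg x hx h a
            · obtain rfl : x = g := Fin.ext h
              exact hno a
        · rw [Expr.eval_reg, ha'] at hb'
          omega
    · have hgT : g ∉ T := by
        intro hcon
        have := t₁ g
        rw [if_pos hcon] at this
        rw [Expr.eval_arr, Expr.eval_reg, hgv, this] at hb
        exact one_ne_zero hb
      refine (Halts.setReg ?_).mono (k := 1) (by omega) (fun _ _ h => h)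
      refine ⟨T.card * (I.m + 1) + (I.m - (g + 1)), by omega, by simp [hgv], T, k,
        ⟨t₁, by simpa using k₁, r₁⟩, by simp [hgv], fun x hx hlt' a => ?_⟩
      simp only [Memory.setReg_reg, if_true, Expr.eval_add, Expr.eval_reg, Expr.eval_one,
        hgv] at hlt'
      rcases Nat.lt_succ_iff_lt_or_eq.1 hlt' with h | h
      · exact hg x hx h a
      · obtain rfl : x = g := Fin.ext h
        exact absurd hx hgT
  · intro j s₁ a₁ ⟨hle, T, k, hR, _, hg⟩ hb
    have b₁ : FairBase I ε s₁ := h.agree a₁ (by decide)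
    have hge : I.m ≤ s₁.reg 32 := by
      by_contra hcon
      simp [b₁.goods', not_le.1 hcon] at hb
    exact ⟨T, k, hR, fun g hgT => hg g hgT (g.2.trans_le hge)⟩
  · exact ⟨by omega, _, k₀, ⟨hT, hk, .refl⟩, by rw [h32, Nat.sub_zero], by simp [h32]⟩

/-- The condition that two expressions have equal values. -/
def eqExpr (e₁ e₂ : Expr) : Expr := (1 - .less e₁ e₂) * (1 - .less e₂ e₁)

theorem eqExpr_eval_ne_zero (e₁ e₂ : Expr) :
    (eqExpr e₁ e₂).eval s ≠ 0 ↔ e₁.eval s = e₂.eval s := by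
  simp only [eqExpr, Expr.eval_mul, Expr.eval_sub, Expr.eval_one, Expr.eval_less]
  split_ifs <;> simp <;> omega

/-- The replacement of the bundle of the agent in register `33`. -/
def updateProgram : Program :=
  .setReg 30 (reg 33 - 1) ;; apxProgram ;;
  fillProgram 4 (eqExpr (arr 4 (reg 20)) (reg 33)) 0 ;;
  fillProgram 4 (arr 13 (reg 20)) (reg 33) ;;
  .setArr 5 (reg 30) (reg 25)

/-- The old bundle of `k` is released before the new one is written. As the new bundle consists of
charity goods, no good of another agent is overwritten. -/
theorem updateProgram_halts (hε : 0 < ε) (hε' : ε < 1) (h : FairBase I ε s)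
    (hA : HoldsValues A s) (hO : FairOutput I A s) {k₀ : Fin I.n} (hR : Reached ε A k₀ T k s)
    (hk₀ : Test dpKnapsack I ε A k₀ (I.charity A)) :
    Halts updateProgram s (fairDPSteps I ε + (I.m * 20 + 24)) fun s' =>
      HoldsValues (Function.update A k (apxKns dpKnapsack I k T (ε / 2))) s' ∧
      FairOutput I (Function.update A k (apxKns dpKnapsack I k T (ε / 2))) s' := by
  obtain ⟨hT, hk, hr⟩ := hR
  set S := apxKns dpKnapsack I k T (ε / 2) with hS
  have hSC : S ⊆ I.charity A :=
    (dpKnapsack_isApproximate.apxKns_spec hε hε' k T).1.trans (shrinkStep_invariant hr hk₀).1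
  refine (Halts.seq (k := 1) (k' := 1 + (fairDPSteps I ε + (I.m * 10 + 12)) +
    (1 + (I.m * 5 + 3) + (1 + (I.m * 5 + 3) + 1))) (Halts.setReg ?_)).mono (by omega)
    (fun _ _ h => h)
  have h30 : (s.setReg 30 ((reg 33 - 1).eval s)).reg 30 = k := by simp [hk]
  refine Halts.seq ((apxProgram_halts hε (h.agree Run.setReg.agree (by decide)) hT h30).mono le_rfl
    fun s₁ a₁ h₁ => ?_)
  rw [← hS] at h₁
  replace h30 : s₁.reg 30 = k := (a₁.1 30 (by decide)).trans h30
  have h33 : s₁.reg 33 = k + 1 := (a₁.1 33 (by decide)).trans (by simpa using hk)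
  have h4 : s₁.arr 4 = s.arr 4 := a₁.2 4 (by decide)
  have h5 : s₁.arr 5 = s.arr 5 := a₁.2 5 (by decide)
  have hm : s₁.reg 10 = I.m :=
    ((h.agree Run.setReg.agree (by decide)).agree a₁ (by decide)).goods'
  refine Halts.seq ((fillProgram_halts hm (fun j => s.arr 4 j = k + 1) (fun _ => 0) ?_).mono
    le_rfl fun s₂ a₂ h₂ => ?_)
  · intro j _ s' ha h20 h4'
    rw [eqExpr_eval_ne_zero]
    simp [h20, h4', ha.1 33 (by decide), h33, h4]
  refine Halts.seq ((fillProgram_halts ((a₂.1 10 (by decide)).trans hm)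
    (fun j => s₁.arr 13 j ≠ 0) (fun _ => k + 1) ?_).mono le_rfl fun s₃ a₃ h₃ => ?_)
  · intro j _ s' ha h20 h4'
    simp [h20, ha.1 33 (by decide), a₂.1 33 (by decide), h33, ha.2 13 (by decide),
      a₂.2 13 (by decide)]
  have h30' : s₃.reg 30 = k := by rw [a₃.1 30 (by decide), a₂.1 30 (by decide), h30]
  have h25 : s₃.reg 25 = ∑ g ∈ S, I.val k g := by
    rw [a₃.1 25 (by decide), a₂.1 25 (by decide), h₁.2]
  have hval : s₃.arr 5 = s.arr 5 := by rw [a₃.2 5 (by decide), a₂.2 5 (by decide), h5]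
  have hout : ∀ g : Fin I.m, s₃.arr 4 g =
      if g ∈ S then (k : ℕ) + 1 else if s.arr 4 g = k + 1 then 0 else s.arr 4 g := by
    intro g
    rw [h₃ g g.2, h₂ g g.2, h₁.1 g, h4]
    by_cases hg : g ∈ S <;> simp [hg]
  refine Halts.setArr ⟨fun a => ?_, fun g => ?_⟩
  · simp only [Expr.eval_reg, h30', h25, Memory.setArr_arr, true_and]
    rcases eq_or_ne a k with rfl | hne
    · simp
    · rw [if_neg (fun hh => hne (Fin.ext hh)), Function.update_of_ne hne, hval]
      exact hA a
  · rw [Memory.setArr_arr, if_neg (by simp), hout g]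
    refine ⟨fun a hga => ?_, fun hgC => ?_⟩
    · rcases eq_or_ne a k with rfl | hne
      · rw [Function.update_self] at hga
        rw [if_pos hga]
      · rw [Function.update_of_ne hne] at hga
        rw [if_neg (fun hh => I.mem_charity.1 (hSC hh) a hga), (hO g).1 a hga,
          if_neg (fun hh => hne (Fin.ext (Nat.succ_injective hh)))]
    · rw [I.mem_charity] at hgC
      have hgS : g ∉ S := by simpa using hgC k
      rw [if_neg hgS]
      by_cases hgk : g ∈ A k
      · rw [if_pos ((hO g).1 k hgk)]
      · have hgC' : g ∈ I.charity A := I.mem_charity.2 fun a => by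
          rcases eq_or_ne a k with rfl | hne
          · exact hgk
          · simpa [hne] using hgC a
        rw [(hO g).2 hgC', if_neg (by omega)]

/-- The test of the while-loop of the algorithm. -/
def prepareProgram : Program :=
  fillProgram 12 1 (.less (arr 4 (reg 20)) 1) ;; searchProgram

theorem prepareProgram_halts (hε : 0 < ε) (hε' : ε < 1) (h : FairBase I ε s)
    (hA : HoldsValues A s) (hO : FairOutput I A s) :
    Halts prepareProgram s (I.m * 5 + 4 + searchSteps I ε) fun s' =>
      IsIndicator (I.charity A) (s'.arr 12) ∧ SearchResult ε A (I.charity A) (s'.reg 31) := by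
  refine (Halts.seq (k := I.m * 5 + 3) (k' := searchSteps I ε) ?_).mono (by omega)
    (fun _ _ h => h)
  refine (fillProgram_halts h.goods' (fun _ => True) (fun j => if s.arr 4 j < 1 then 1 else 0)
    ?_).mono le_rfl fun s₁ a₁ h₁ => ?_
  · intro j _ s' ha h20 _
    simp [h20, ha.2 4 (by decide)]
  have t₁ : IsIndicator (I.charity A) (s₁.arr 12) := by
    intro g
    rw [h₁ g g.2, if_pos trivial]
    by_cases hg : g ∈ I.charity A
    · simp [hg, (hO g).2 hg]
    · rw [if_neg hg]
      rw [I.mem_charity] at hg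
      push Not at hg
      obtain ⟨a, ha⟩ := hg
      simp [(hO g).1 a ha]
  refine (searchProgram_halts (A := A) hε hε' (h.agree a₁ (by decide)) (fun a => ?_) t₁).mono le_rfl
    fun s₂ a₂ h₂ => ⟨?_, h₂⟩
  · rw [a₁.2 5 (by decide)]; exact hA a
  · rw [a₂.2 12 (by decide)]; exact t₁

def mainLoop : Program := .loop (reg 31) (shrinkProgram ;; updateProgram ;; prepareProgram)

/-- `ComputeApproxFEFx`. -/
def fairProgram : Program :=
  .setReg 10 (reg 1) ;; .setReg 13 (reg 2) ;; .setReg 14 (reg 3 + reg 3) ;;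
  prepareProgram ;; mainLoop

def iterationSteps (I : FairInstance) (ε : ℚ) : ℕ :=
  (I.m * (I.m + 1) + I.m) * (searchSteps I ε + 9) + fairDPSteps I ε + searchSteps I ε
    + I.m * 25 + 50

/-- Termination is inherited from the algorithm: the measure is the number of iterations left in the
bound of `AfterIterations.le`. -/
theorem mainLoop_halts (hε : 0 < ε) (hε' : ε < 1) (h : FairBase I ε s)
    (hA : HoldsValues A s) (hO : FairOutput I A s) (hT : IsIndicator (I.charity A) (s.arr 12))
    (hS : SearchResult ε A (I.charity A) (s.reg 31)) (hA₀ : AfterIterations dpKnapsack I ε 0 A) :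
    Halts mainLoop s
      (I.n * (⌈2 / ε⌉₊ * I.inputSize ε + 1) * (iterationSteps I ε + 1) + 1) fun s' =>
      ∃ A : I.Bundles, FairOutput I A s' ∧ Returns dpKnapsack I ε A := by
  set M := I.n * (⌈2 / ε⌉₊ * I.inputSize ε + 1) with hM
  refine Halts.loop (k := iterationSteps I ε) (fun j s' => ∃ (A : I.Bundles) (t : ℕ),
    j + t = M ∧ AfterIterations dpKnapsack I ε t A ∧ HoldsValues A s' ∧ FairOutput I A s' ∧
      IsIndicator (I.charity A) (s'.arr 12) ∧ SearchResult ε A (I.charity A) (s'.reg 31)) ?_ ?_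
    M ⟨A, 0, rfl, hA₀, hA, hO, hT, hS⟩
  · intro j s₁ a₁ ⟨A, t, hjt, hAt, v₁, o₁, t₁, r₁⟩ hb
    have b₁ : FairBase I ε s₁ := h.agree a₁ (by decide)
    obtain ⟨k₀, hk₀, htest⟩ := r₁.resolve_left fun hh => hb hh.1
    -- every iteration is an iteration of the algorithm
    have hnext : ∀ T k, ApxMinEnvied dpKnapsack I ε A T k →
        AfterIterations dpKnapsack I ε (t + 1) (Function.update A k T) := fun T k hTk =>
      .update hAt ⟨k₀, htest⟩ hTk
    -- Another iteration is possible, so `t + 1` also respects the bound `M`.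
    have hj : 0 < j := by
      obtain ⟨T, k, hTk⟩ := exists_apxMinEnvied ⟨k₀, htest⟩
      have := (hnext T k hTk).le dpKnapsack_isApproximate hε hε'
      omega
    refine ⟨hj, ?_⟩
    refine (Halts.seq
      (k := 1 + 1 + (1 + 1 + ((I.m * (I.m + 1) + I.m) * (searchSteps I ε + 9) + 1)))
      (k' := 1 + (fairDPSteps I ε + (I.m * 20 + 24)) + (I.m * 5 + 4 + searchSteps I ε)) ?_).mono
      (by rw [iterationSteps]; omega) (fun _ _ h => h)
    have hshrink : Halts shrinkProgram s₁
        (1 + 1 + (1 + 1 + ((I.m * (I.m + 1) + I.m) * (searchSteps I ε + 9) + 1))) fun s' =>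
        ∃ T k, Reached ε A k₀ T k s' ∧
          ∀ g ∈ T, ∀ a, ¬ Test dpKnapsack I ε A a (T.erase g) :=
      Halts.seq (Halts.setReg (Halts.seq (Halts.setReg
        (shrinkLoop_halts hε hε'
          ((b₁.agree Run.setReg.agree (by decide)).agree Run.setReg.agree (by decide))
          v₁ t₁ (by simpa using hk₀) (by simp)))))
    refine hshrink.mono le_rfl fun s₂ a₂ ⟨T, k, hR, hend⟩ => ?_
    have b₂ := b₁.agree a₂ (by decide)
    have v₂ : HoldsValues A s₂ := fun a => by rw [a₂.2 5 (by decide)]; exact v₁ a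
    have o₂ : FairOutput I A s₂ := fun g => by rw [a₂.2 4 (by decide)]; exact o₁ g
    refine Halts.seq ((updateProgram_halts hε hε' b₂ v₂ o₂ hR htest).mono le_rfl
      fun s₃ a₃ ⟨v₃, o₃⟩ => ?_)
    have b₃ := b₂.agree a₃ (by decide)
    refine (prepareProgram_halts hε hε' b₃ v₃ o₃).mono le_rfl fun s₄ a₄ ⟨t₄, r₄⟩ => ?_
    refine ⟨j - 1, by omega, _, t + 1, by omega,
      hnext _ k ⟨k₀, T, htest, hR.2.2, hend, rfl⟩, fun a => ?_, fun g => ?_, t₄, r₄⟩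
    · rw [a₄.2 5 (by decide)]; exact v₃ a
    · rw [a₄.2 4 (by decide)]; exact o₃ g
  · intro j s₁ _ ⟨A, t, _, hAt, _, o₁, _, r₁⟩ hb
    refine ⟨A, o₁, ⟨t, hAt⟩, fun ⟨a, ha⟩ => ?_⟩
    rcases r₁ with ⟨_, hno⟩ | ⟨a', ha', _⟩
    · exact hno a ha
    · rw [Expr.eval_reg, ha'] at hb
      omega

def fairSteps (I : FairInstance) (ε : ℚ) : ℕ :=
  I.n * (⌈2 / ε⌉₊ * I.inputSize ε + 1) * (iterationSteps I ε + 1) + I.m * 5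
    + searchSteps I ε + 20

theorem fairProgram_halts (hε : 0 < ε) (hε' : ε < 1) :
    Halts fairProgram (fairInput I ε) (fairSteps I ε) fun s' =>
      ∃ A : I.Bundles, FairOutput I A s' ∧ Returns dpKnapsack I ε A := by
  refine (Halts.seq (k := 1) (k' := 1 + 1 + (1 + 1 + (1 + (I.m * 5 + 4 + searchSteps I ε) +
    (I.n * (⌈2 / ε⌉₊ * I.inputSize ε + 1) * (iterationSteps I ε + 1) + 1)))) ?_).mono
    (by rw [fairSteps]; omega) (fun _ _ h => h)
  refine Halts.setReg (Halts.seq (Halts.setReg (Halts.seq (Halts.setReg (Halts.seq ?_)))))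
  have hb : FairBase I ε ((((fairInput I ε).setReg 10 I.m).setReg 13 ε.num.natAbs).setReg 14
      (ε.den + ε.den)) := by
    constructor <;> simp [fairInput]
  refine (prepareProgram_halts (A := fun _ => ∅) hε hε' hb ?_ ?_).mono le_rfl
    fun s₁ a₁ ⟨t₁, r₁⟩ => ?_
  -- The zeros of the initial memory already encode empty bundles of value zero.
  · intro a; simp [fairInput]
  · intro g; simp [fairInput]
  · refine mainLoop_halts hε hε' (hb.agree a₁ (by decide)) ?_ ?_ t₁ r₁ .start
    · intro a; simp [a₁.2 5 (by decide), fairInput]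
    · intro g; simp [a₁.2 4 (by decide), fairInput]

/-! ### Polynomial running time of the whole program. -/

theorem size_ofMatrix_le {n m : ℕ} (f : Fin n → Fin m → ℕ) (i : ℕ) :
    (ofMatrix f i).size ≤ ∑ a, ∑ g, (f a g).size := by
  unfold ofMatrix
  split_ifs with h
  · exact (Finset.single_le_sum (f := fun g => (f ⟨i / m, h.1⟩ g).size) (fun _ _ => Nat.zero_le _)
      (Finset.mem_univ _)).trans (Finset.single_le_sum (f := fun a => ∑ g, (f a g).size)
        (fun _ _ => Nat.zero_le _) (Finset.mem_univ _))
  · simp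

theorem fairInput_sizeLE (I : FairInstance) (ε : ℚ) :
    (fairInput I ε).SizeLE (I.inputSize ε) := by
  have hs : I.inputSize ε = I.n + I.m + (∑ a, ∑ g, (I.val a g).size + ∑ a, ∑ g, (I.size a g).size)
      + (∑ a, (I.budget a).num.size + ∑ a, (I.budget a).den.size) + ε.num.natAbs.size
      + ε.den.size := by
    rw [FairInstance.inputSize]
    simp only [Finset.sum_add_distrib]
  rw [hs]
  constructor
  · intro r
    have := size_le_self I.n
    have := size_le_self I.m
    rcases r with _ | _ | _ | _ | r <;> simp only [fairInput]
    all_goals first | omega | simp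
  · intro α i
    rcases α with _ | _ | _ | _ | α <;> simp only [fairInput]
    · have := size_ofMatrix_le I.val i; omega
    · have := size_ofMatrix_le I.size i; omega
    · have := size_ofVector_le (fun a => (I.budget a).num) i; omega
    · have := size_ofVector_le (fun a => (I.budget a).den) i; omega
    · simp

namespace FairInstance

/-- The parameters of an input. -/
def sizeData (I : FairInstance) (ε : ℚ) (h : 0 < ε ∧ ε < 1) : SizeData where
  n := I.n
  m := I.m
  ε := ε
  B := I.inputSize ε
  pos := h.1
  le_one := h.2.le
  n_le := by rw [inputSize]; omega
  m_le := by rw [inputSize]; omega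

end FairInstance

namespace SizeData

/-- A bound for the number of iterations of the algorithm. -/
def iterations (x : SizeData) : ℕ := x.n * (⌈2 / x.ε⌉₊ * x.B + 1)

def searchSteps (x : SizeData) : ℕ := x.n * (x.dpSteps 2 + (x.m * 10 + 18)) + 5

def iterationSteps (x : SizeData) : ℕ :=
  (x.m * (x.m + 1) + x.m) * (x.searchSteps + 9) + x.dpSteps 2 + x.searchSteps + x.m * 25 + 50

def fairSteps (x : SizeData) : ℕ :=
  x.iterations * (x.iterationSteps + 1) + x.m * 5 + x.searchSteps + 20

theorem polyBounded_iterations : PolyBounded Y iterations :=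
  polyBounded_n.mul (((polyBounded_ceil 2).mul polyBounded_B).add one_le_Y (.const 1))

theorem polyBounded_searchSteps : PolyBounded Y searchSteps :=
  (polyBounded_n.mul ((polyBounded_dpSteps 2).add one_le_Y
    ((polyBounded_m.mul (.const 10)).add one_le_Y (.const 18)))).add one_le_Y (.const 5)

theorem polyBounded_iterationSteps : PolyBounded Y iterationSteps :=
  (((((((polyBounded_m.mul (polyBounded_m.add one_le_Y (.const 1))).add one_le_Y
    polyBounded_m).mul (polyBounded_searchSteps.add one_le_Y (.const 9))).add one_le_Y
    (polyBounded_dpSteps 2)).add one_le_Y polyBounded_searchSteps).add one_le_Y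
    (polyBounded_m.mul (.const 25))).add one_le_Y (.const 50))

theorem polyBounded_fairSteps : PolyBounded Y fairSteps :=
  (((polyBounded_iterations.mul (polyBounded_iterationSteps.add one_le_Y (.const 1))).add one_le_Y
    (polyBounded_m.mul (.const 5))).add one_le_Y polyBounded_searchSteps).add one_le_Y (.const 20)

end SizeData

/-- The parameter `2` reflects that the knapsack routine is called with accuracy `ε / 2`. -/
theorem fairDPSteps_le (h : 0 < ε ∧ ε < 1) : fairDPSteps I ε ≤ (I.sizeData ε h).dpSteps 2 := by
  refine dpSteps_mono ((scaledBound_le _ _ _).trans (le_of_eq ?_))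
  have h₁ : ((ε.den + ε.den : ℕ) : ℚ) / ε.num.natAbs = (2 : ℕ) / ε := by
    conv_rhs => rw [← natAbs_num_div_den h.1]
    rw [div_div_eq_mul_div]
    push_cast
    ring
  rw [h₁]; rfl

theorem fairSteps_le (h : 0 < ε ∧ ε < 1) : fairSteps I ε ≤ (I.sizeData ε h).fairSteps := by
  have h₁ := fairDPSteps_le (I := I) h
  have h₂ : searchSteps I ε ≤ (I.sizeData ε h).searchSteps :=
    Nat.add_le_add_right (Nat.mul_le_mul_left _ (Nat.add_le_add_right h₁ _)) _
  have h₃ : iterationSteps I ε ≤ (I.sizeData ε h).iterationSteps :=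
    Nat.add_le_add_right (Nat.add_le_add_right (Nat.add_le_add (Nat.add_le_add
      (Nat.mul_le_mul_left _ (Nat.add_le_add_right h₂ _)) h₁) h₂) _) _
  exact Nat.add_le_add_right (Nat.add_le_add (Nat.add_le_add_right
    (Nat.mul_le_mul_left _ (Nat.add_le_add_right h₃ _)) _) h₂) _

/-- `ComputeApproxFEFx` with the dynamic programming routine is computed by a program in
polynomial time. -/
theorem exists_fairProgram :
    ∃ (P : Program) (c d : ℕ), ∀ (I : FairInstance) (ε : ℚ), 0 < ε → ε < 1 →
      ∃ (A : I.Bundles) (s : Memory) (t : ℕ), Exec P (fairInput I ε) s t ∧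
        (t : ℚ) ≤ c * (1 / ε + I.inputSize ε) ^ d ∧ FairOutput I A s ∧
        Returns dpKnapsack I ε A := by
  obtain ⟨c, d, h⟩ := PolyBounded.exec SizeData.one_le_Y (p := fairProgram) (by decide)
    SizeData.polyBounded_fairSteps SizeData.polyBounded_B
  refine ⟨fairProgram, c, d, fun I ε hε hε' => ?_⟩
  obtain ⟨s, k, hk, hr, A, hO, hA⟩ := fairProgram_halts (I := I) hε hε'
  obtain ⟨t, ht, hle⟩ := h (I.sizeData ε ⟨hε, hε'⟩) _ s k (hk.trans (fairSteps_le _))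
    (fairInput_sizeLE I ε) hr
  exact ⟨A, s, t, ht, hle, hO, hA⟩

/-- The number of iterations of `ComputeApproxFEFx` is polynomial. -/
theorem exists_iterations_le :
    ∃ c d : ℕ, ∀ K : KnapsackRoutine, K.IsApproximate →
      ∀ (I : FairInstance) (ε : ℚ), 0 < ε → ε < 1 →
        ∀ (t : ℕ) (A : I.Bundles), AfterIterations K I ε t A →
          (t : ℚ) ≤ c * (1 / ε + I.inputSize ε) ^ d := by
  obtain ⟨c, d, h⟩ := SizeData.polyBounded_iterations
  refine ⟨c, d, fun K hK I ε hε hε' t A hA => le_trans ?_ (h (I.sizeData ε ⟨hε, hε'⟩))⟩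
  exact_mod_cast hA.le hK hε hε'

end FairProgram

end FairDivision

open FairDivision
theorem mainTheorem6 :
    -- the algorithm with an arbitrary `(1 - δ)`-approximate knapsack routine, on every run
    (∃ c d : ℕ, ∀ K : KnapsackRoutine, K.IsApproximate →
      ∀ (I : FairInstance) (ε : ℚ), 0 < ε → ε < 1 →
        (∀ (t : ℕ) (A : I.Bundles), AfterIterations K I ε t A →
          (t : ℚ) ≤ c * (1 / ε + I.inputSize ε) ^ d ∧
          I.IsAllocation A ∧
          (LoopCondition K I ε A → ∃ T k, ApxMinEnvied K I ε A T k) ∧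
          (∀ T k, ApxMinEnvied K I ε A T k →
            T ⊆ I.charity A ∧ I.IsApproxMinEnvied ε A T k ∧
            1 / (1 - ε / 2) * I.value k (A k) < I.value k T)) ∧
        (∀ A : I.Bundles, Returns K I ε A → I.IsAllocation A ∧ I.IsApproxFEFx ε A)) ∧
    -- the algorithm with a knapsack FPTAS, as a program that runs in polynomial time
    (∃ K : KnapsackRoutine, K.IsFPTAS ∧
      ∃ (P : Program) (c d : ℕ), ∀ (I : FairInstance) (ε : ℚ), 0 < ε → ε < 1 →
        ∃ (A : I.Bundles) (s : Memory) (t : ℕ),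
          Exec P (fairInput I ε) s t ∧
          (t : ℚ) ≤ c * (1 / ε + I.inputSize ε) ^ d ∧
          FairOutput I A s ∧
          Returns K I ε A ∧ I.IsAllocation A ∧ I.IsApproxFEFx ε A) := by
  obtain ⟨c, d, h⟩ := exists_iterations_le
  obtain ⟨P, c', d', hP⟩ := exists_fairProgram
  refine ⟨⟨c, d, fun K hK I ε hε hε' => ⟨fun t A hA => ⟨h K hK I ε hε hε' t A hA,
    hA.isAllocation hK hε hε', exists_apxMinEnvied, fun T k hT => ?_⟩,
    fun A hA => hA.isAllocation_and_isApproxFEFx hK hε hε'⟩⟩,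
    dpKnapsack, dpKnapsack_isFPTAS, P, c', d', fun I ε hε hε' => ?_⟩
  · obtain ⟨h₁, h₂, _⟩ := hT.spec hK hε hε'
    exact ⟨h₁, h₂, hT.value_lt hK hε hε'⟩
  · obtain ⟨A, s, t, ht, hle, hO, hA⟩ := hP I ε hε hε'
    exact ⟨A, s, t, ht, hle, hO, hA,
      hA.isAllocation_and_isApproxFEFx dpKnapsack_isApproximate hε hε'⟩
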